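/- Let $M$ be a connected (Hausdorff, second countable) $C^\infty$ manifold of dimension $n=n^++n^-$, oriented by a volume form $\mathbf v$. Let $p\colon\mathfrak M\to M$ be the bundle of pseudo-Riemannian metrics of signature $(n^+,n^-)$ and $J^r\mathfrak M$ its $r$-jet bundle. For a metric $g$ let $\nabla^g$ be its Levi-Civita connection, $s^g$ its scalar curvature and $\mathbf v_g$ its volume form, oriented like $\mathbf v$. For a symmetric linear connection $\nabla$ on $M$ put $T^{g,\nabla}=\nabla^g-\nabla$ and define functions on $J^2\mathfrak M$ by $$L'^{\nabla}(j^2_xg)=c\Big(\big(\mathrm{alt}_{23}(\nabla^gT^{g,\nabla})_x\big)^\sharp\Big),\qquad L^\nabla(j^2_xg)\,\mathbf v_x=\big\{s^g(x)+L'^\nabla(j^2_xg)\big\}(\mathbf v_g)_x .$$ Here $(\nabla^gT)(X,Y,Z)=(\nabla^g_ZT)(X,Y)$, $(\mathrm{alt}_{23}W)(X,Y,Z)=W(X,Y,Z)-W(X,Z,Y)$, ${}^\sharp$ raises the third covariant index by $g$, and $c$ contracts the two remaining covariant indices with the two contravariant ones in order (the first covariant index with the raised one); in coordinates $L'^\nabla=g^{jr}\big((\nabla^g_jT)^i_{ri}-(\nabla^g_iT)^i_{rj}\big)$.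 A diffeomorphism $\phi$ of $M$ acts on connections by $(\phi\cdot\nabla)_XY=\phi\cdot(\nabla_{\phi^{-1}\cdot X}(\phi^{-1}\cdot Y))$ and on $\mathfrak M$ by $\bar\phi(g_x)=(\phi^{-1})^*g_x$, with lifts $\bar\phi^{(r)}(j^r_xg)=j^r_{\phi(x)}(\bar\phi\circ g\circ\phi^{-1})$. Then for every symmetric linear connection $\nabla$ and every diffeomorphism $\phi$ of $M$: 1. $\phi^{-1}\cdot\nabla$ is a symmetric linear connection, and $L'^\nabla\circ\bar\phi^{(2)}=L'^{\,\phi^{-1}\cdot\nabla}$ on $J^2\mathfrak M$. 2. $L^\nabla$ and $L^{\phi^{-1}\cdot\nabla}$ factor through $J^1\mathfrak M$, and, as Lagrangian densities on $J^1\mathfrak M$, $(\bar\phi^{(1)})^*(L^\nabla\mathbf v)=\varepsilon\,L^{\phi^{-1}\cdot\nabla}\mathbf v$, where $\varepsilon=1$ if $\phi$ preserves the orientation given by $\mathbf v$ and $\varepsilon=-1$ if $\phi$ reverses it (as $M$ is connected, one of the two is the case). In particular $(\bar\phi^{(1)})^*(L^\nabla\mathbf v)=L^{\phi^{-1}\cdot\nabla}\mathbf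 v$ for every orientation-preserving $\phi$. -/

import Mathlib

set_option maxSynthPendingDepth 3

open scoped Manifold ContDiff Topology

noncomputable section

namespace EHLagrangian

/-- The model space of an `n`-manifold. -/
abbrev Model (n : ℕ) : Type := EuclideanSpace ℝ (Fin n)

/-- The standard basis vector `e_i` of the model space. -/
abbrev stdVec {n : ℕ} (i : Fin n) : Model n := EuclideanSpace.single i (1 : ℝ)

/-- The dual basis covector `e^i` of the model space. -/
abbrev stdCovec {n : ℕ} (i : Fin n) : Model n →L[ℝ] ℝ := EuclideanSpace.proj i

/-- A bilinear form has signature `(p, q)` if it has an orthonormal basis with `p` vectors of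
square `1` and `q` vectors of square `-1` (so it is symmetric and nondegenerate). -/
def HasSignature (p q : ℕ) {V : Type*} [AddCommGroup V] [Module ℝ V] [TopologicalSpace V]
    [IsTopologicalAddGroup V] [ContinuousSMul ℝ V] (b : V →L[ℝ] V →L[ℝ] ℝ) : Prop :=
  ∃ e : Module.Basis (Fin p ⊕ Fin q) ℝ V, ∀ i j,
    b (e i) (e j) = if i = j then Sum.elim (fun _ ↦ 1) (fun _ ↦ -1) i else 0

/-- The pullback of a bilinear form along a linear map. -/
def pullForm {V W : Type*} [AddCommGroup V] [Module ℝ V] [TopologicalSpace V]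
    [IsTopologicalAddGroup V] [ContinuousSMul ℝ V] [AddCommGroup W] [Module ℝ W]
    [TopologicalSpace W] [IsTopologicalAddGroup W] [ContinuousSMul ℝ W]
    (b : W →L[ℝ] W →L[ℝ] ℝ) (A : V →L[ℝ] W) : V →L[ℝ] V →L[ℝ] ℝ :=
  (ContinuousLinearMap.precomp ℝ A) ∘L b ∘L A

@[simp]
theorem pullForm_apply {V W : Type*} [AddCommGroup V] [Module ℝ V] [TopologicalSpace V]
    [IsTopologicalAddGroup V] [ContinuousSMul ℝ V] [AddCommGroup W] [Module ℝ W]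
    [TopologicalSpace W] [IsTopologicalAddGroup W] [ContinuousSMul ℝ W]
    (b : W →L[ℝ] W →L[ℝ] ℝ) (A : V →L[ℝ] W) (v w : V) :
    pullForm b A v w = b (A v) (A w) := rfl

/-! ### Tensor calculus in a coordinate domain of `ℝⁿ` -/

section Coordinates

variable {n : ℕ}

/-- `(a, b) ↦ (c ↦ B a b c + B b a c - B c a b)`. -/
def koszul (B : Model n →L[ℝ] Model n →L[ℝ] Model n →L[ℝ] ℝ) :
    Model n →L[ℝ] Model n →L[ℝ] Model n →L[ℝ] ℝ :=
  B + B.flip - ((ContinuousLinearMap.flipₗᵢ ℝ (Model n) (Model n) ℝ :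
    (Model n →L[ℝ] Model n →L[ℝ] ℝ) →L[ℝ] (Model n →L[ℝ] Model n →L[ℝ] ℝ)) ∘L B.flip)

theorem koszul_apply (B : Model n →L[ℝ] Model n →L[ℝ] Model n →L[ℝ] ℝ) (a b c : Model n) :
    koszul B a b c = B a b c + B b a c - B c a b := by
  simp [koszul]

/-- The isomorphism `♯ : V* → V` given by a nondegenerate bilinear form. -/
def sharp (b : Model n →L[ℝ] Model n →L[ℝ] ℝ) : (Model n →L[ℝ] ℝ) →L[ℝ] Model n :=
  ContinuousLinearMap.inverse b

/-- The Christoffel symbols of the Levi-Civita connection of the metric `G`, as a bilinear map: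
`leviCivita G u a b = (∇^G_a b)(u)` for constant vector fields `a`, `b`. -/
def leviCivita (G : Model n → Model n →L[ℝ] Model n →L[ℝ] ℝ) (u : Model n) :
    Model n →L[ℝ] Model n →L[ℝ] Model n :=
  (1 / 2 : ℝ) • ((ContinuousLinearMap.compL ℝ (Model n) (Model n →L[ℝ] ℝ) (Model n)
    (sharp (G u))) ∘L koszul (fderiv ℝ G u))

theorem leviCivita_apply (G : Model n → Model n →L[ℝ] Model n →L[ℝ] ℝ) (u a b : Model n) :
    leviCivita G u a b = (1 / 2 : ℝ) • sharp (G u) (koszul (fderiv ℝ G u) a b) := rfl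

/-- The curvature `R(a, b)c` of the linear connection with Christoffel symbols `Γ`. -/
def curvature (Γ : Model n → Model n →L[ℝ] Model n →L[ℝ] Model n) (u a b c : Model n) :
    Model n :=
  fderiv ℝ Γ u a b c - fderiv ℝ Γ u b a c + Γ u a (Γ u b c) - Γ u b (Γ u a c)

/-- The Ricci tensor `S(a, b) = trace (z ↦ R(z, a)b)`. -/
def ricci (Γ : Model n → Model n →L[ℝ] Model n →L[ℝ] Model n) (u a b : Model n) : ℝ :=
  ∑ j, stdCovec j (curvature Γ u (stdVec j) a b)

/-- The scalar curvature `s^G`, the trace with respect to `G` of the Ricci tensor of `∇^G`. -/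
def scalarCurvature (G : Model n → Model n →L[ℝ] Model n →L[ℝ] ℝ) (u : Model n) : ℝ :=
  ∑ i, ricci (leviCivita G) u (stdVec i) (sharp (G u) (stdCovec i))

/-- The covariant derivative of a `2`-covariant, `1`-contravariant tensor field `T` with respect to
the linear connection with Christoffel symbols `Γ`, the direction of differentiation being the last
argument: `(∇T)(a, b, c) = (∇_c T)(a, b)`. -/
def nablaTensor (Γ T : Model n → Model n →L[ℝ] Model n →L[ℝ] Model n) (u a b c : Model n) :
    Model n :=
  fderiv ℝ T u c a b + Γ u c (T u a b) - T u (Γ u c a) b - T u a (Γ u c b)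

/-- Alternation of the second and third covariant indices. -/
def alt23 (W : Model n → Model n → Model n → Model n) (a b c : Model n) : Model n :=
  W a b c - W a c b

/-- The isomorphism `⊗³V* ⊗ V → ⊗²V* ⊗ ⊗²V` that raises the third covariant index,
`w₁ ⊗ w₂ ⊗ w₃ ⊗ X ↦ w₁ ⊗ w₂ ⊗ (w₃)♯ ⊗ X`; the first contravariant index is a covector argument. -/
def raiseThird (b : Model n →L[ℝ] Model n →L[ℝ] ℝ) (W : Model n → Model n → Model n → Model n)
    (a₁ a₂ : Model n) (α : Model n →L[ℝ] ℝ) : Model n :=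
  W a₁ a₂ (sharp b α)

/-- The total contraction of the first and second covariant indices with the first and second
contravariant ones. -/
def totalContraction (Q : Model n → Model n → (Model n →L[ℝ] ℝ) → Model n) : ℝ :=
  ∑ i, ∑ j, stdCovec j (Q (stdVec i) (stdVec j) (stdCovec i))

/-- `c((alt₂₃ (∇^G T))♯)` for `T = ∇^G - ∇`, where `G` is a metric and `Γ` are the Christoffel
symbols of `∇`. -/
def lagrangianPrimeCoord (G : Model n → Model n →L[ℝ] Model n →L[ℝ] ℝ)
    (Γ : Model n → Model n →L[ℝ] Model n →L[ℝ] Model n) (u : Model n) : ℝ :=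
  totalContraction (raiseThird (G u)
    (alt23 (nablaTensor (leviCivita G) (fun w ↦ leviCivita G w - Γ w) u)))

/-! The quantities above depend only on the `2`-jet of the metric. -/

theorem isInvertible_of_injective {b : Model n →L[ℝ] Model n →L[ℝ] ℝ}
    (hb : Function.Injective b) : b.IsInvertible := by
  have hd : Module.finrank ℝ (Model n) = Module.finrank ℝ (Model n →L[ℝ] ℝ) := by
    rw [← (LinearMap.toContinuousLinearMap (𝕜 := ℝ) (E := Model n) (F' := ℝ)).finrank_eq]
    exact (Subspace.dual_finrank_eq (K := ℝ) (V := Model n)).symm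
  let e := (LinearEquiv.ofInjectiveOfFinrankEq (b : Model n →ₗ[ℝ] Model n →L[ℝ] ℝ) hb hd)
  exact ⟨e.toContinuousLinearEquiv, by ext; rfl⟩

/-- Two metric fields have the same `r`-jet at `u` in coordinates. -/
def SameJet (r : ℕ) (G G' : Model n → Model n →L[ℝ] Model n →L[ℝ] ℝ) (u : Model n) : Prop :=
  ∀ k ≤ r, iteratedFDeriv ℝ k G u = iteratedFDeriv ℝ k G' u

theorem SameJet.eq_zero {r : ℕ} {G G' : Model n → Model n →L[ℝ] Model n →L[ℝ] ℝ} {u : Model n}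
    (h : SameJet r G G' u) : G u = G' u := by
  have := congrArg (fun f ↦ f ![]) (h 0 (Nat.zero_le _))
  simpa using this

theorem SameJet.eq_one {G G' : Model n → Model n →L[ℝ] Model n →L[ℝ] ℝ} {u : Model n}
    (h : SameJet 2 G G' u) : fderiv ℝ G u = fderiv ℝ G' u := by
  ext1 a
  have := congrArg (fun f ↦ f ![a]) (h 1 (by norm_num))
  simpa using this

theorem SameJet.eq_two {G G' : Model n → Model n →L[ℝ] Model n →L[ℝ] ℝ} {u : Model n}
    (h : SameJet 2 G G' u) : fderiv ℝ (fderiv ℝ G) u = fderiv ℝ (fderiv ℝ G') u := by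
  ext1 a
  ext1 b
  have := congrArg (fun f ↦ f ![a, b]) (h 2 le_rfl)
  simpa [iteratedFDeriv_two_apply] using this

theorem leviCivita_congr {G G' : Model n → Model n →L[ℝ] Model n →L[ℝ] ℝ} {u : Model n}
    (h : SameJet 2 G G' u) : leviCivita G u = leviCivita G' u := by
  simp only [leviCivita, h.eq_zero, h.eq_one]

/-- The dependence of the Christoffel symbols on the `1`-jet of the metric. -/
def leviCivitaFun (P : (Model n →L[ℝ] Model n →L[ℝ] ℝ) ×
    (Model n →L[ℝ] Model n →L[ℝ] Model n →L[ℝ] ℝ)) : Model n →L[ℝ] Model n →L[ℝ] Model n :=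
  (1 / 2 : ℝ) • ((ContinuousLinearMap.compL ℝ (Model n) (Model n →L[ℝ] ℝ) (Model n)
    (sharp P.1)) ∘L koszul P.2)

theorem differentiableAt_leviCivitaFun {P : (Model n →L[ℝ] Model n →L[ℝ] ℝ) ×
    (Model n →L[ℝ] Model n →L[ℝ] Model n →L[ℝ] ℝ)} (hP : P.1.IsInvertible) :
    DifferentiableAt ℝ leviCivitaFun P := by
  have h1 : DifferentiableAt ℝ (fun P : (Model n →L[ℝ] Model n →L[ℝ] ℝ) ×
      (Model n →L[ℝ] Model n →L[ℝ] Model n →L[ℝ] ℝ) ↦ sharp P.1) P := by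
    have := (hP.contDiffAt_map_inverse (n := 1)).differentiableAt one_ne_zero
    exact this.comp P differentiableAt_fst
  have hflip : Differentiable ℝ (fun B : Model n →L[ℝ] Model n →L[ℝ] Model n →L[ℝ] ℝ ↦ B.flip) :=
    (ContinuousLinearMap.flipₗᵢ ℝ (Model n) (Model n) (Model n →L[ℝ] ℝ)).toContinuousLinearEquiv.differentiable
  have h2 : Differentiable ℝ (koszul (n := n)) := by
    unfold koszul
    exact (differentiable_id.add hflip).sub ((differentiable_const _).clm_comp hflip)
  have h3 : DifferentiableAt ℝ (fun P : (Model n →L[ℝ] Model n →L[ℝ] ℝ) ×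
      (Model n →L[ℝ] Model n →L[ℝ] Model n →L[ℝ] ℝ) ↦ koszul P.2) P :=
    (h2 P.2).comp P differentiableAt_snd
  exact ((((ContinuousLinearMap.compL ℝ (Model n) (Model n →L[ℝ] ℝ)
    (Model n)).differentiableAt).comp P h1).clm_comp h3).const_smul (1 / 2 : ℝ)

theorem hasFDerivAt_leviCivita {G : Model n → Model n →L[ℝ] Model n →L[ℝ] ℝ} {u : Model n}
    (hG : ContDiffAt ℝ ∞ G u) (hi : (G u).IsInvertible) :
    HasFDerivAt (leviCivita G) ((fderiv ℝ leviCivitaFun (G u, fderiv ℝ G u)) ∘L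
      ((fderiv ℝ G u).prod (fderiv ℝ (fderiv ℝ G) u))) u := by
  have h1 : HasFDerivAt G (fderiv ℝ G u) u := (hG.differentiableAt (by simp)).hasFDerivAt
  have h2 : HasFDerivAt (fderiv ℝ G) (fderiv ℝ (fderiv ℝ G) u) u :=
    ((hG.fderiv_right (m := 1) (by norm_cast)).differentiableAt one_ne_zero).hasFDerivAt
  have h3 : HasFDerivAt leviCivitaFun (fderiv ℝ leviCivitaFun (G u, fderiv ℝ G u))
      (G u, fderiv ℝ G u) := (differentiableAt_leviCivitaFun hi).hasFDerivAt
  exact HasFDerivAt.comp u h3 (h1.prodMk h2)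

variable {G G' : Model n → Model n →L[ℝ] Model n →L[ℝ] ℝ} {u : Model n}

theorem fderiv_leviCivita_congr (h : SameJet 2 G G' u) (hG : ContDiffAt ℝ ∞ G u)
    (hG' : ContDiffAt ℝ ∞ G' u) (hi : (G u).IsInvertible) :
    fderiv ℝ (leviCivita G) u = fderiv ℝ (leviCivita G') u := by
  rw [(hasFDerivAt_leviCivita hG hi).fderiv,
    (hasFDerivAt_leviCivita hG' (h.eq_zero ▸ hi)).fderiv, h.eq_zero, h.eq_one, h.eq_two]

theorem scalarCurvature_congr (h : SameJet 2 G G' u) (hG : ContDiffAt ℝ ∞ G u)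
    (hG' : ContDiffAt ℝ ∞ G' u) (hi : (G u).IsInvertible) :
    scalarCurvature G u = scalarCurvature G' u := by
  simp only [scalarCurvature, ricci, curvature, fderiv_leviCivita_congr h hG hG' hi,
    leviCivita_congr h, h.eq_zero]

theorem lagrangianPrimeCoord_congr (Γ : Model n → Model n →L[ℝ] Model n →L[ℝ] Model n)
    (h : SameJet 2 G G' u) (hG : ContDiffAt ℝ ∞ G u)
    (hG' : ContDiffAt ℝ ∞ G' u) (hi : (G u).IsInvertible) :
    lagrangianPrimeCoord G Γ u = lagrangianPrimeCoord G' Γ u := by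
  have hd := (hasFDerivAt_leviCivita hG hi).differentiableAt
  have hd' := (hasFDerivAt_leviCivita hG' (h.eq_zero ▸ hi)).differentiableAt
  have key : fderiv ℝ (fun w ↦ leviCivita G w - Γ w) u =
      fderiv ℝ (fun w ↦ leviCivita G' w - Γ w) u := by
    by_cases hΓ : DifferentiableAt ℝ Γ u
    · rw [fderiv_fun_sub hd hΓ, fderiv_fun_sub hd' hΓ, fderiv_leviCivita_congr h hG hG' hi]
    · rw [fderiv_zero_of_not_differentiableAt, fderiv_zero_of_not_differentiableAt]
      · intro H
        exact hΓ (by simpa [Pi.sub_def] using hd'.sub H)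
      · intro H
        exact hΓ (by simpa [Pi.sub_def] using hd.sub H)
  simp only [lagrangianPrimeCoord, totalContraction, raiseThird, alt23, nablaTensor, key,
    leviCivita_congr h, h.eq_zero]

/-! Changes of coordinates preserve equality of jets. -/

theorem vanish_bilinear {F₁ F₂ F₃ : Type*} [NormedAddCommGroup F₁] [NormedSpace ℝ F₁]
    [NormedAddCommGroup F₂] [NormedSpace ℝ F₂] [NormedAddCommGroup F₃] [NormedSpace ℝ F₃]
    (B : F₁ →L[ℝ] F₂ →L[ℝ] F₃) {f : Model n → F₁} {g : Model n → F₂} {s : Set (Model n)}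
    (hs : IsOpen s) (hu : u ∈ s) (hf : ContDiffOn ℝ ∞ f s)
    (hg : ContDiffOn ℝ ∞ g s) {r : ℕ} (h : ∀ k ≤ r, iteratedFDerivWithin ℝ k f s u = 0) :
    ∀ k ≤ r, iteratedFDerivWithin ℝ k (fun w ↦ B (f w) (g w)) s u = 0 := by
  intro k hk
  have := B.norm_iteratedFDerivWithin_le_of_bilinear hf hg hs.uniqueDiffOn hu
    (n := k) (by exact_mod_cast le_top)
  rw [Finset.sum_eq_zero] at this
  · simpa using this
  · intro i hi
    rw [h i ((Nat.lt_succ_iff.1 (Finset.mem_range.1 hi)).trans hk)]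
    simp

theorem vanish_comp {F : Type*} [NormedAddCommGroup F] [NormedSpace ℝ F]
    {f : Model n → F} {χ : Model n → Model n} {s t : Set (Model n)}
    (hs : IsOpen s) (ht : IsOpen t) (hu : u ∈ s) (hst : Set.MapsTo χ s t)
    (hf : ContDiffOn ℝ ∞ f t) (hχ : ContDiffOn ℝ ∞ χ s) {r : ℕ}
    (h : ∀ k ≤ r, iteratedFDerivWithin ℝ k f t (χ u) = 0) :
    ∀ k ≤ r, iteratedFDerivWithin ℝ k (f ∘ χ) s u = 0 := by
  intro k hk
  have := norm_iteratedFDerivWithin_comp_le hf hχ (n := k) (by exact_mod_cast le_top)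
    ht.uniqueDiffOn hs.uniqueDiffOn hst hu (C := 0)
    (D := 1 + ∑ i ∈ Finset.range (k + 1), ‖iteratedFDerivWithin ℝ i χ s u‖)
    (fun i hi ↦ by rw [h i (hi.trans hk)]; simp)
    (fun i hi hik ↦ by
      have h1 : ‖iteratedFDerivWithin ℝ i χ s u‖ ≤
          ∑ i ∈ Finset.range (k + 1), ‖iteratedFDerivWithin ℝ i χ s u‖ :=
        Finset.single_le_sum (f := fun i ↦ ‖iteratedFDerivWithin ℝ i χ s u‖)
          (fun _ _ ↦ norm_nonneg _) (Finset.mem_range.2 (Nat.lt_succ_of_le hik))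
      have h2 : 0 ≤ ∑ i ∈ Finset.range (k + 1), ‖iteratedFDerivWithin ℝ i χ s u‖ :=
        Finset.sum_nonneg fun _ _ ↦ norm_nonneg _
      refine le_trans (by linarith) (le_self_pow₀ ?_ (by omega))
      linarith)
  simpa using this

/-- `G` pulled back along `χ`. -/
def pullMetric (χ : Model n → Model n) (G : Model n → Model n →L[ℝ] Model n →L[ℝ] ℝ)
    (w : Model n) : Model n →L[ℝ] Model n →L[ℝ] ℝ :=
  pullForm (G (χ w)) (fderiv ℝ χ w)

theorem pullMetric_eq (χ : Model n → Model n) (G : Model n → Model n →L[ℝ] Model n →L[ℝ] ℝ) :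
    pullMetric χ G = fun w ↦
      (ContinuousLinearMap.compL ℝ (Model n) (Model n →L[ℝ] ℝ) (Model n →L[ℝ] ℝ)).flip
        (ContinuousLinearMap.compL ℝ (Model n) (Model n) (Model n →L[ℝ] ℝ) ((G ∘ χ) w)
          (fderiv ℝ χ w))
        ((ContinuousLinearMap.compL ℝ (Model n) (Model n) ℝ).flip (fderiv ℝ χ w)) := rfl

theorem pullMetric_sub (χ : Model n → Model n) :
    pullMetric χ (fun w ↦ G w - G' w) = fun w ↦ pullMetric χ G w - pullMetric χ G' w := by
  ext w a b
  simp [pullMetric]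

variable {χ : Model n → Model n} {s t : Set (Model n)}

theorem contDiffOn_pullMetric (hs : IsOpen s) (hst : Set.MapsTo χ s t)
    (hG : ContDiffOn ℝ ∞ G t) (hχ : ContDiffOn ℝ ∞ χ s) :
    ContDiffOn ℝ ∞ (pullMetric χ G) s := by
  have hA : ContDiffOn ℝ ∞ (fderiv ℝ χ) s := hχ.fderiv_of_isOpen hs (by simp)
  rw [pullMetric_eq]
  exact ((ContinuousLinearMap.contDiff _).comp_contDiffOn
      (((ContinuousLinearMap.contDiff _).comp_contDiffOn (hG.comp hχ hst)).clm_apply hA)).clm_apply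
    ((ContinuousLinearMap.contDiff _).comp_contDiffOn hA)

theorem vanish_pullMetric (hs : IsOpen s) (ht : IsOpen t) (hu : u ∈ s) (hst : Set.MapsTo χ s t)
    (hG : ContDiffOn ℝ ∞ G t) (hχ : ContDiffOn ℝ ∞ χ s) {r : ℕ}
    (h : ∀ k ≤ r, iteratedFDerivWithin ℝ k G t (χ u) = 0) :
    ∀ k ≤ r, iteratedFDerivWithin ℝ k (pullMetric χ G) s u = 0 := by
  have hA : ContDiffOn ℝ ∞ (fderiv ℝ χ) s := hχ.fderiv_of_isOpen hs (by simp)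
  rw [pullMetric_eq]
  refine vanish_bilinear _ hs hu ?_ ((ContinuousLinearMap.contDiff _).comp_contDiffOn hA)
    (vanish_bilinear _ hs hu (hG.comp hχ hst) hA (vanish_comp hs ht hu hst hG hχ h))
  exact ((ContinuousLinearMap.contDiff _).comp_contDiffOn (hG.comp hχ hst)).clm_apply hA

theorem sameJet_iff (hs : IsOpen s) (hu : u ∈ s) (hG : ContDiffOn ℝ ∞ G s)
    (hG' : ContDiffOn ℝ ∞ G' s) {r : ℕ} : SameJet r G G' u ↔
      ∀ k ≤ r, iteratedFDerivWithin ℝ k (fun w ↦ G w - G' w) s u = 0 := by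
  refine forall₂_congr fun k _ ↦ ?_
  have hk : (k : ℕ∞ω) ≤ ∞ := by exact_mod_cast le_top
  rw [fun_iteratedFDerivWithin_sub_apply ((hG u hu).of_le hk) ((hG' u hu).of_le hk)
    hs.uniqueDiffOn hu, sub_eq_zero, iteratedFDerivWithin_of_isOpen k hs hu,
    iteratedFDerivWithin_of_isOpen k hs hu]

theorem sameJet_pullMetric (hs : IsOpen s) (ht : IsOpen t) (hu : u ∈ s) (hst : Set.MapsTo χ s t)
    (hG : ContDiffOn ℝ ∞ G t) (hG' : ContDiffOn ℝ ∞ G' t) (hχ : ContDiffOn ℝ ∞ χ s) {r : ℕ}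
    (h : SameJet r G G' (χ u)) : SameJet r (pullMetric χ G) (pullMetric χ G') u := by
  rw [sameJet_iff hs hu (contDiffOn_pullMetric hs hst hG hχ) (contDiffOn_pullMetric hs hst hG' hχ),
    ← pullMetric_sub]
  exact vanish_pullMetric hs ht hu hst (hG.sub hG') hχ ((sameJet_iff ht (hst hu) hG hG').1 h)

theorem SameJet.congr {r : ℕ} {K K' : Model n → Model n →L[ℝ] Model n →L[ℝ] ℝ}
    (h : SameJet r G G' u) (hK : K =ᶠ[𝓝 u] G) (hK' : K' =ᶠ[𝓝 u] G') : SameJet r K K' u := by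
  intro k hk
  rw [(hK.iteratedFDeriv ℝ k).eq_of_nhds, (hK'.iteratedFDeriv ℝ k).eq_of_nhds, h k hk]

end Coordinates

/-! ### Jets of metrics -/

section Manifold

variable {n : ℕ} {M : Type*} [TopologicalSpace M] [ChartedSpace (Model n) M]

/-- The coordinate frame at `y` of the preferred chart at `x`: the vector `a = ∑ aⁱ eᵢ` is sent to
`∑ aⁱ (∂/∂xⁱ)_y`. -/
def chartFrame (x y : M) : Model n →L[ℝ] TangentSpace (𝓡 n) y :=
  (mfderiv (𝓡 n) (𝓡 n) (extChartAt (𝓡 n) x) y).inverse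

/-- The components `g_{ij}(y)` at `y` of a field of bilinear forms in the preferred chart at `x`. -/
def formInFrame (g : Π y : M, TangentSpace (𝓡 n) y →L[ℝ] TangentSpace (𝓡 n) y →L[ℝ] ℝ)
    (x y : M) : Model n →L[ℝ] Model n →L[ℝ] ℝ :=
  pullForm (g y) (chartFrame x y)

/-- The components of a field of bilinear forms in the preferred chart at `x`, as functions of the
coordinates. -/
def formInChart (g : Π y : M, TangentSpace (𝓡 n) y →L[ℝ] TangentSpace (𝓡 n) y →L[ℝ] ℝ)
    (x : M) (u : Model n) : Model n →L[ℝ] Model n →L[ℝ] ℝ :=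
  formInFrame g x ((extChartAt (𝓡 n) x).symm u)

theorem isInvertible_chart [IsManifold (𝓡 n) ∞ M] {x y : M} (hy : y ∈ (extChartAt (𝓡 n) x).source) :
    (mfderiv (𝓡 n) (𝓡 n) (extChartAt (𝓡 n) x) y).IsInvertible :=
  isInvertible_mfderiv_extChartAt hy

/-- The image `φ̄ ∘ g ∘ φ⁻¹` of a field of bilinear forms under a diffeomorphism, where
`φ̄(g_y) = (φ⁻¹)^* g_y`. -/
def pushField (φ : M ≃ₘ⟮𝓡 n, 𝓡 n⟯ M)
    (g : Π y : M, TangentSpace (𝓡 n) y →L[ℝ] TangentSpace (𝓡 n) y →L[ℝ] ℝ) (z : M) :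
    TangentSpace (𝓡 n) z →L[ℝ] TangentSpace (𝓡 n) z →L[ℝ] ℝ :=
  pullForm (g (φ.symm z)) (mfderiv (𝓡 n) (𝓡 n) φ.symm z)

/-- The expression of `φ⁻¹` in the preferred charts at `φ x` and `x`. -/
def coordInv (φ : M ≃ₘ⟮𝓡 n, 𝓡 n⟯ M) (x : M) (u : Model n) : Model n :=
  extChartAt (𝓡 n) x (φ.symm ((extChartAt (𝓡 n) (φ x)).symm u))

/-- The domain of `coordInv`. -/
def coordDomain (φ : M ≃ₘ⟮𝓡 n, 𝓡 n⟯ M) (x : M) : Set (Model n) :=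
  (extChartAt (𝓡 n) (φ x)).target ∩
    (extChartAt (𝓡 n) (φ x)).symm ⁻¹' (φ.symm ⁻¹' (extChartAt (𝓡 n) x).source)

theorem isOpen_coordDomain (φ : M ≃ₘ⟮𝓡 n, 𝓡 n⟯ M) (x : M) : IsOpen (coordDomain φ x) :=
  (continuousOn_extChartAt_symm (φ x)).isOpen_inter_preimage (isOpen_extChartAt_target (φ x))
    ((isOpen_extChartAt_source x).preimage φ.symm.continuous)

theorem mem_coordDomain (φ : M ≃ₘ⟮𝓡 n, 𝓡 n⟯ M) (x : M) :
    extChartAt (𝓡 n) (φ x) (φ x) ∈ coordDomain φ x := by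
  refine ⟨mem_extChartAt_target _, ?_⟩
  simp

theorem coordInv_base (φ : M ≃ₘ⟮𝓡 n, 𝓡 n⟯ M) (x : M) :
    coordInv φ x (extChartAt (𝓡 n) (φ x) (φ x)) = extChartAt (𝓡 n) x x := by
  simp [coordInv]

variable [IsManifold (𝓡 n) ∞ M]

theorem contDiffOn_coordInv (φ : M ≃ₘ⟮𝓡 n, 𝓡 n⟯ M) (x : M) :
    ContDiffOn ℝ ∞ (coordInv φ x) (coordDomain φ x) := by
  rw [← contMDiffOn_iff_contDiffOn]
  have h1 : ContMDiffOn (𝓡 n) (𝓡 n) ∞ (extChartAt (𝓡 n) (φ x)).symm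
      (extChartAt (𝓡 n) (φ x)).target := contMDiffOn_extChartAt_symm _
  have h2 : ContMDiffOn (𝓡 n) (𝓡 n) ∞ (extChartAt (𝓡 n) x) (extChartAt (𝓡 n) x).source := by
    simpa using (contMDiffOn_extChartAt (I := 𝓡 n) (n := ∞) (x := x))
  have h3 : ContMDiffOn (𝓡 n) (𝓡 n) ∞ (φ.symm ∘ (extChartAt (𝓡 n) (φ x)).symm)
      (coordDomain φ x) := φ.symm.contMDiff.comp_contMDiffOn (h1.mono Set.inter_subset_left)
  exact h2.comp h3 fun u hu ↦ hu.2

theorem fderiv_coordInv (φ : M ≃ₘ⟮𝓡 n, 𝓡 n⟯ M) (x : M) {z : M}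
    (hz : z ∈ (extChartAt (𝓡 n) (φ x)).source) (hz' : φ.symm z ∈ (extChartAt (𝓡 n) x).source) :
    (mfderiv (𝓡 n) (𝓡 n) φ.symm z) ∘L chartFrame (φ x) z =
      chartFrame x (φ.symm z) ∘L fderiv ℝ (coordInv φ x) (extChartAt (𝓡 n) (φ x) z) := by
  have hu : extChartAt (𝓡 n) (φ x) z ∈ coordDomain φ x :=
    ⟨(extChartAt (𝓡 n) (φ x)).map_source hz, by
      rw [Set.mem_preimage, Set.mem_preimage, (extChartAt (𝓡 n) (φ x)).left_inv hz]
      exact hz'⟩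
  have hχ : MDifferentiableAt (𝓡 n) (𝓡 n) (coordInv φ x) (extChartAt (𝓡 n) (φ x) z) :=
    (((contDiffOn_coordInv φ x).contDiffAt ((isOpen_coordDomain φ x).mem_nhds hu)).differentiableAt
      (by simp)).mdifferentiableAt
  have hc' : MDifferentiableAt (𝓡 n) (𝓡 n) (extChartAt (𝓡 n) (φ x)) z :=
    mdifferentiableAt_extChartAt (by simpa using hz)
  have hc : MDifferentiableAt (𝓡 n) (𝓡 n) (extChartAt (𝓡 n) x) (φ.symm z) :=
    mdifferentiableAt_extChartAt (by simpa using hz')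
  have hφ : MDifferentiableAt (𝓡 n) (𝓡 n) φ.symm z := φ.symm.mdifferentiable (by simp) z
  have hcomp : (coordInv φ x ∘ extChartAt (𝓡 n) (φ x)) =ᶠ[𝓝 z]
      (extChartAt (𝓡 n) x ∘ φ.symm) := by
    filter_upwards [(isOpen_extChartAt_source (I := 𝓡 n) (φ x)).mem_nhds hz] with w hw
    rw [Function.comp_apply, Function.comp_apply, coordInv, (extChartAt (𝓡 n) (φ x)).left_inv hw]
  have h := hcomp.mfderiv_eq (I := 𝓡 n) (I' := 𝓡 n)
  rw [mfderiv_comp z hχ hc', mfderiv_comp z hc hφ] at h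
  obtain ⟨e, he⟩ := isInvertible_chart hz'
  obtain ⟨e', he'⟩ := isInvertible_chart hz
  rw [mfderiv_eq_fderiv] at h
  unfold chartFrame
  rw [← he, ← he', ContinuousLinearMap.inverse_equiv, ContinuousLinearMap.inverse_equiv]
  rw [← he, ← he'] at h
  ext1 a
  have h' := congrArg (fun L ↦ e.symm (L (e'.symm a))) h
  erw [ContinuousLinearMap.comp_apply, ContinuousLinearMap.comp_apply] at h'
  erw [ContinuousLinearEquiv.symm_apply_apply, ContinuousLinearEquiv.apply_symm_apply] at h'
  exact h'.symm

theorem pushField_inChart (φ : M ≃ₘ⟮𝓡 n, 𝓡 n⟯ M) (x : M)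
    (g : Π y : M, TangentSpace (𝓡 n) y →L[ℝ] TangentSpace (𝓡 n) y →L[ℝ] ℝ) {u : Model n}
    (hu : u ∈ coordDomain φ x) :
    formInChart (pushField φ g) (φ x) u =
      pullForm (formInChart g x (coordInv φ x u)) (fderiv ℝ (coordInv φ x) u) := by
  have hz := (extChartAt (𝓡 n) (φ x)).map_target hu.1
  have h := fderiv_coordInv φ x hz hu.2
  rw [(extChartAt (𝓡 n) (φ x)).right_inv hu.1] at h
  have hy : (extChartAt (𝓡 n) x).symm (coordInv φ x u) =
      φ.symm ((extChartAt (𝓡 n) (φ x)).symm u) := (extChartAt (𝓡 n) x).left_inv hu.2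
  rw [formInChart, formInChart, hy]
  ext a b
  have ha := congrArg (fun L ↦ L a) h
  have hb := congrArg (fun L ↦ L b) h
  simp only [ContinuousLinearMap.comp_apply] at ha hb
  simp only [formInFrame, pullForm_apply, pushField]
  rw [ha, hb]

/-- A local section at `x` of the bundle `𝔐 → M` of pseudo-Riemannian metrics of signature `(p, q)`:
a field of bilinear forms that is smooth and of signature `(p, q)` in a neighbourhood of `x` (its
values away from `x` are irrelevant). -/
structure LocalMetric {M : Type*} [TopologicalSpace M] (p q : ℕ) [ChartedSpace (Model (p + q)) M]
    (x : M) where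
  /-- the field of bilinear forms -/
  form : Π y : M, TangentSpace (𝓡 (p + q)) y →L[ℝ] TangentSpace (𝓡 (p + q)) y →L[ℝ] ℝ
  smooth : ∀ᶠ u in 𝓝 (extChartAt (𝓡 (p + q)) x x), ContDiffAt ℝ ∞ (formInChart form x) u
  signature : ∀ᶠ y in 𝓝 x, HasSignature p q (form y)

end Manifold

section JetSpaces

variable {p q : ℕ} {M : Type*} [TopologicalSpace M] [ChartedSpace (Model (p + q)) M]

theorem HasSignature.injective {V : Type*} [AddCommGroup V] [Module ℝ V] [TopologicalSpace V]
    [IsTopologicalAddGroup V] [ContinuousSMul ℝ V] {b : V →L[ℝ] V →L[ℝ] ℝ}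
    (h : HasSignature p q b) : Function.Injective b := by
  obtain ⟨e, he⟩ := h
  rw [injective_iff_map_eq_zero]
  intro v hv
  have key : ∀ j, e.repr v j = 0 := by
    intro j
    have h1 : b v (e j) = 0 := by rw [hv]; rfl
    rw [← e.sum_repr v, map_sum, sum_apply,
      Finset.sum_eq_single j] at h1
    · rcases j with j | j <;> simpa [he] using h1
    · intro i _ hij
      simp [he, hij]
    · simp
  exact e.repr.map_eq_zero_iff.1 (Finsupp.ext key)

theorem HasSignature.pull {V W : Type*} [AddCommGroup V] [Module ℝ V] [TopologicalSpace V]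
    [IsTopologicalAddGroup V] [ContinuousSMul ℝ V] [AddCommGroup W] [Module ℝ W]
    [TopologicalSpace W] [IsTopologicalAddGroup W] [ContinuousSMul ℝ W]
    {b : W →L[ℝ] W →L[ℝ] ℝ} (h : HasSignature p q b) (A : V ≃L[ℝ] W) :
    HasSignature p q (pullForm b (A : V →L[ℝ] W)) := by
  obtain ⟨e, he⟩ := h
  exact ⟨e.map A.symm.toLinearEquiv, fun i j ↦ by simp [he]⟩

theorem LocalMetric.contDiffAt {x : M} (g : LocalMetric p q x) :
    ContDiffAt ℝ ∞ (formInChart g.form x) (extChartAt (𝓡 (p + q)) x x) :=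
  g.smooth.self_of_nhds

variable [IsManifold (𝓡 (p + q)) ∞ M]

theorem LocalMetric.isInvertible {x : M} (g : LocalMetric p q x) :
    (formInChart g.form x (extChartAt (𝓡 (p + q)) x x)).IsInvertible := by
  obtain ⟨e, he⟩ := isInvertible_chart (n := p + q) (mem_extChartAt_source (I := 𝓡 (p + q)) x)
  apply isInvertible_of_injective
  rw [formInChart, extChartAt_to_inv, formInFrame, chartFrame, ← he,
    ContinuousLinearMap.inverse_equiv]
  exact (g.signature.self_of_nhds.pull e.symm).injective

/-- The transformed local section `φ̄ ∘ g ∘ φ⁻¹` at `φ x`. -/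
def LocalMetric.push (φ : M ≃ₘ⟮𝓡 (p + q), 𝓡 (p + q)⟯ M) {x : M} (g : LocalMetric p q x) :
    LocalMetric p q (φ x) where
  form := pushField φ g.form
  smooth := by
    obtain ⟨t, ht, hto, hxt⟩ := eventually_nhds_iff.1 g.smooth
    have hs := (contDiffOn_coordInv φ x).continuousOn.isOpen_inter_preimage
      (isOpen_coordDomain φ x) hto
    have hmem : extChartAt (𝓡 (p + q)) (φ x) (φ x) ∈ coordDomain φ x ∩ coordInv φ x ⁻¹' t :=
      ⟨mem_coordDomain φ x, by rw [Set.mem_preimage, coordInv_base]; exact hxt⟩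
    filter_upwards [hs.mem_nhds hmem] with u hu
    have hc : ContDiffOn ℝ ∞ (pullMetric (coordInv φ x) (formInChart g.form x))
        (coordDomain φ x ∩ coordInv φ x ⁻¹' t) :=
      contDiffOn_pullMetric hs (fun w hw ↦ hw.2) (fun w hw ↦ (ht w hw).contDiffWithinAt)
        ((contDiffOn_coordInv φ x).mono Set.inter_subset_left)
    refine (hc.contDiffAt (hs.mem_nhds hu)).congr_of_eventuallyEq ?_
    filter_upwards [hs.mem_nhds hu] with w hw
    exact pushField_inChart φ x g.form hw.1
  signature := by
    have h : Filter.Tendsto φ.symm (𝓝 (φ x)) (𝓝 x) := by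
      simpa using φ.symm.continuous.continuousAt (x := φ x) |>.tendsto
    filter_upwards [h.eventually g.signature] with z hz
    exact hz.pull (φ.symm.mfderivToContinuousLinearEquiv (by simp) z)

variable (p q) in
/-- Two local sections at `x` have the same `r`-jet at `x` if their components in a chart have the
same partial derivatives of order at most `r` at `x`. -/
def jetSetoid (r : ℕ) (x : M) : Setoid (LocalMetric p q x) where
  r g g' := SameJet r (formInChart g.form x) (formInChart g'.form x)
    (extChartAt (𝓡 (p + q)) x x)
  iseqv := ⟨fun _ _ _ ↦ rfl, fun h k hk ↦ (h k hk).symm,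
    fun h h' k hk ↦ (h k hk).trans (h' k hk)⟩

variable (p q M) in
/-- The `r`-jet bundle `J^r 𝔐` of the bundle of metrics of signature `(p, q)` on `M`. -/
def Jet (r : ℕ) : Type _ := Σ x : M, Quotient (jetSetoid p q r x)

/-- The `r`-jet `j^r_x g`. -/
def jet (r : ℕ) {x : M} (g : LocalMetric p q x) : Jet p q M r := ⟨x, Quotient.mk _ g⟩

/-- The projection `J^r 𝔐 → M`. -/
def Jet.base {r : ℕ} (j : Jet p q M r) : M := j.1

/-- The projection `J² 𝔐 → J¹ 𝔐`. -/
def Jet.toOne (j : Jet p q M 2) : Jet p q M 1 :=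
  ⟨j.1, Quotient.map' id (fun _ _ (h : SameJet 2 _ _ _) k hk ↦ h k (hk.trans one_le_two)) j.2⟩

theorem sameJet_push (φ : M ≃ₘ⟮𝓡 (p + q), 𝓡 (p + q)⟯ M) {r : ℕ} {x : M}
    {g g' : LocalMetric p q x} (h : (jetSetoid p q r x).r g g') :
    (jetSetoid p q r (φ x)).r (g.push φ) (g'.push φ) := by
  obtain ⟨t, ht, hto, hxt⟩ := eventually_nhds_iff.1 (g.smooth.and g'.smooth)
  have hs := (contDiffOn_coordInv φ x).continuousOn.isOpen_inter_preimage
    (isOpen_coordDomain φ x) hto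
  have hmem : extChartAt (𝓡 (p + q)) (φ x) (φ x) ∈ coordDomain φ x ∩ coordInv φ x ⁻¹' t :=
    ⟨mem_coordDomain φ x, by rw [Set.mem_preimage, coordInv_base]; exact hxt⟩
  have h' : SameJet r (formInChart g.form x) (formInChart g'.form x)
      (coordInv φ x (extChartAt (𝓡 (p + q)) (φ x) (φ x))) := by
    rw [coordInv_base]; exact h
  refine (sameJet_pullMetric hs hto hmem (fun w hw ↦ hw.2)
    (fun w hw ↦ (ht w hw).1.contDiffWithinAt) (fun w hw ↦ (ht w hw).2.contDiffWithinAt)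
    ((contDiffOn_coordInv φ x).mono Set.inter_subset_left) h').congr ?_ ?_
  · filter_upwards [hs.mem_nhds hmem] with w hw
    exact pushField_inChart φ x g.form hw.1
  · filter_upwards [hs.mem_nhds hmem] with w hw
    exact pushField_inChart φ x g'.form hw.1

/-- The lift `φ̄^(r) : J^r 𝔐 → J^r 𝔐`, `φ̄^(r)(j^r_x g) = j^r_{φ x}(φ̄ ∘ g ∘ φ⁻¹)`. -/
def jetLift (φ : M ≃ₘ⟮𝓡 (p + q), 𝓡 (p + q)⟯ M) (r : ℕ) (j : Jet p q M r) : Jet p q M r :=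
  ⟨φ j.1, Quotient.map' (LocalMetric.push φ) (fun _ _ h ↦ sameJet_push φ h) j.2⟩

/-! ### Linear connections -/

/-- The space of linear connections on `M`. -/
abbrev Connection (n : ℕ) (M : Type*) [TopologicalSpace M] [ChartedSpace (Model n) M] 
    [IsManifold (𝓡 n) ∞ M] :=
  CovariantDerivative (𝓡 n) (Model n) (TangentSpace (𝓡 n) : M → Type _)

section Connections

variable {n : ℕ} {M : Type*} [TopologicalSpace M] [ChartedSpace (Model n) M]
  [IsManifold (𝓡 n) ∞ M]

/-- Smooth and torsion-free linear connections. -/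
def IsSymmetricConnection (D : Connection n M) : Prop :=
  D.ContMDiffCovariantDerivative ∞ ∧ D.torsion = 0

theorem isInvertible_diffeo (φ : M ≃ₘ⟮𝓡 n, 𝓡 n⟯ M) (x : M) :
    (mfderiv (𝓡 n) (𝓡 n) φ x).IsInvertible :=
  ⟨φ.mfderivToContinuousLinearEquiv (by simp) x, rfl⟩

theorem pullback_pullback (φ : M ≃ₘ⟮𝓡 n, 𝓡 n⟯ M) (Y : Π x : M, TangentSpace (𝓡 n) x) (x : M) :
    (mfderiv (𝓡 n) (𝓡 n) φ.symm x).inverse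
      (VectorField.mpullback (𝓡 n) (𝓡 n) φ Y (φ.symm x)) = Y x := by
  have h1 : VectorField.mpullback (𝓡 n) (𝓡 n) (φ ∘ φ.symm) Y x =
      VectorField.mpullback (𝓡 n) (𝓡 n) φ.symm (VectorField.mpullback (𝓡 n) (𝓡 n) φ Y) x := by
    simp only [VectorField.mpullback]
    rw [mfderiv_comp x (φ.mdifferentiable (by simp) _) (φ.symm.mdifferentiable (by simp) _),
      ContinuousLinearMap.IsInvertible.inverse_comp_apply_of_right (isInvertible_diffeo φ.symm x)]
    rfl
  have h2 : (φ ∘ φ.symm : M → M) = id := by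
    ext y
    simp
  rw [h2, VectorField.mpullback_id] at h1
  exact h1.symm

/-- The image `φ · D` of a linear connection under a diffeomorphism,
`(φ · D)_X Y = φ · (D_{φ⁻¹ · X} (φ⁻¹ · Y))`. Here `D Y y (X y)` stands for `(D_X Y)(y)`,
`φ⁻¹ · Y` is the pullback of the vector field `Y`, and `φ · Z` is the pullback of `Z` under
`φ⁻¹`. -/
def pushConnection (φ : M ≃ₘ⟮𝓡 n, 𝓡 n⟯ M) (D : Connection n M) : Connection n M where
  toFun Y x := (mfderiv (𝓡 n) (𝓡 n) φ.symm x).inverse ∘L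
    D (VectorField.mpullback (𝓡 n) (𝓡 n) φ Y) (φ.symm x) ∘L mfderiv (𝓡 n) (𝓡 n) φ.symm x
  isCovariantDerivativeOnUniv := by
    have hpull : ∀ {Y : Π x : M, TangentSpace (𝓡 n) x} {x : M},
        MDifferentiableAt (𝓡 n) (𝓡 n).tangent (fun y ↦ (⟨y, Y y⟩ : TangentBundle (𝓡 n) M)) x →
        MDifferentiableAt (𝓡 n) (𝓡 n).tangent
          (fun y ↦ (⟨y, VectorField.mpullback (𝓡 n) (𝓡 n) φ Y y⟩ : TangentBundle (𝓡 n) M))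
          (φ.symm x) := by
      intro Y x hY
      refine MDifferentiableAt.mpullback_vectorField (n := ∞) ?_ φ.contMDiffAt
        (isInvertible_diffeo φ _) (by norm_cast)
      rwa [φ.apply_symm_apply]
    constructor
    · intro Y Y' x hY hY' _
      rw [VectorField.mpullback_add, D.isCovariantDerivativeOnUniv.add (hpull hY) (hpull hY')]
      ext v
      simp
    · intro Y g x hY hg _
      have hgφ : MDifferentiableAt (𝓡 n) 𝓘(ℝ, ℝ) (g ∘ φ) (φ.symm x) :=
        MDifferentiableAt.comp (φ.symm x) (by rwa [φ.apply_symm_apply])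
          (φ.mdifferentiable (by simp) _)
      have hd : mvfderiv (𝓡 n) g x =
          (mvfderiv (𝓡 n) (g ∘ φ) (φ.symm x)) ∘L mfderiv (𝓡 n) (𝓡 n) φ.symm x := by
        rw [← mvfderiv_comp x hgφ (φ.symm.mdifferentiable (by simp) _)]
        congr 1
        ext y
        simp
      rw [VectorField.mpullback_smul, D.isCovariantDerivativeOnUniv.leibniz (hpull hY) hgφ, hd]
      ext1 v
      simp only [ContinuousLinearMap.comp_apply, add_apply, smul_apply,
        ContinuousLinearMap.smulRight_apply, map_add, map_smul, Function.comp_apply,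
        φ.apply_symm_apply, pullback_pullback]

/-- The Christoffel symbols of `D` in the preferred chart at `x`, as a bilinear map depending on the
coordinates: `(a, b) ↦ ∑ aⁱ bᵏ D_{∂ᵢ} ∂ₖ`, expressed in coordinates. -/
def connectionSymbols (D : Connection n M) (x : M) (u : Model n) :
    Model n →L[ℝ] Model n →L[ℝ] Model n :=
  ∑ k, (ContinuousLinearMap.smulRightL ℝ (Model n) (Model n) (stdCovec k)) ∘L
    ((mfderiv (𝓡 n) (𝓡 n) (extChartAt (𝓡 n) x) ((extChartAt (𝓡 n) x).symm u)) ∘L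
      (D (fun y ↦ chartFrame x y (stdVec k)) ((extChartAt (𝓡 n) x).symm u)) ∘L
      chartFrame x ((extChartAt (𝓡 n) x).symm u))

/-- A volume form: a smooth nowhere vanishing `n`-form. -/
structure VolumeForm (n : ℕ) (M : Type*) [TopologicalSpace M] [ChartedSpace (Model n) M] where
  /-- the underlying field of alternating forms -/
  form : Π x : M, TangentSpace (𝓡 n) x [⋀^Fin n]→L[ℝ] ℝ
  ne_zero : ∀ x, form x ≠ 0
  smooth : ∀ x, ContDiffOn ℝ ∞ (fun u ↦ form ((extChartAt (𝓡 n) x).symm u)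
    fun i ↦ chartFrame x ((extChartAt (𝓡 n) x).symm u) (stdVec i)) (extChartAt (𝓡 n) x).target

end Connections

/-! ### The Lagrangians -/

/-- The scalar curvature `s^g(x)` as a function of `j²_x g`. -/
def jetScalarCurvature (j : Jet p q M 2) : ℝ :=
  Quotient.lift (s := jetSetoid p q 2 j.1)
    (fun g ↦ scalarCurvature (formInChart g.form j.1) (extChartAt (𝓡 (p + q)) j.1 j.1))
    (fun g g' h ↦ scalarCurvature_congr h g.contDiffAt g'.contDiffAt g.isInvertible) j.2

/-- The Lagrangian `L'^D`, where `D` is a linear connection: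
`L'^D(j²_x g) = c((alt₂₃ (∇^g T^{g,D})_x)♯)` with `T^{g,D} = ∇^g - D`. -/
def lagrangianPrime (D : Connection (p + q) M) (j : Jet p q M 2) : ℝ :=
  Quotient.lift (s := jetSetoid p q 2 j.1)
    (fun g ↦ lagrangianPrimeCoord (formInChart g.form j.1) (connectionSymbols D j.1)
      (extChartAt (𝓡 (p + q)) j.1 j.1))
    (fun g g' h ↦ lagrangianPrimeCoord_congr _ h g.contDiffAt g'.contDiffAt g.isInvertible) j.2

/-- The function `ρ` with `v_g = ρ v`, where `v_g` is the volume form of `g`, oriented like `v`: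
`ρ = √|det g(∂ᵢ, ∂ⱼ)| / |v(∂₁, …, ∂ₙ)|`, which is the same for every basis `∂₁, …, ∂ₙ` of `T_x M`
and equals `√|det g(∂ᵢ, ∂ⱼ)|` in coordinates with `v = dx¹ ∧ … ∧ dxⁿ`. -/
def jetRho (v : VolumeForm (p + q) M) {r : ℕ} (j : Jet p q M r) : ℝ :=
  Quotient.lift (s := jetSetoid p q r j.1)
    (fun g ↦ √|Matrix.det (Matrix.of fun i k ↦
        formInChart g.form j.1 (extChartAt (𝓡 (p + q)) j.1 j.1) (stdVec i) (stdVec k))| /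
      |v.form j.1 fun i ↦ chartFrame j.1 j.1 (stdVec i)|)
    (fun g g' h ↦ by
      have h' : SameJet r (formInChart g.form j.1) (formInChart g'.form j.1)
        (extChartAt (𝓡 (p + q)) j.1 j.1) := h
      simp only [h'.eq_zero]) j.2

/-- The Lagrangian `L^D`: `L^D(j²_x g) v_x = (s^g(x) + L'^D(j²_x g)) (v_g)_x`. -/
def lagrangian (v : VolumeForm (p + q) M) (D : Connection (p + q) M) (j : Jet p q M 2) : ℝ :=
  (jetScalarCurvature j + lagrangianPrime D j) * jetRho v j

variable (p q M) in
/-- Lagrangian densities of order `r`, i.e. horizontal `n`-forms on `J^r 𝔐`, seen as maps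
`J^r 𝔐 → Λⁿ T^*M` over `M`. -/
abbrev Density (r : ℕ) : Type _ :=
  Π j : Jet p q M r, TangentSpace (𝓡 (p + q)) j.1 [⋀^Fin (p + q)]→L[ℝ] ℝ

/-- The Lagrangian density `L v`. -/
def densityOf (v : VolumeForm (p + q) M) {r : ℕ} (L : Jet p q M r → ℝ) : Density p q M r :=
  fun j ↦ L j • v.form j.1

/-- The pullback `(φ̄^(r))^* Λ` of a Lagrangian density. As `φ̄^(r)` covers `φ`, it is the pullback
along the differential of `φ` of the value at `φ̄^(r)(j)`. -/
def pullDensity (φ : M ≃ₘ⟮𝓡 (p + q), 𝓡 (p + q)⟯ M) {r : ℕ} (Λ : Density p q M r) :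
    Density p q M r :=
  fun j ↦ (Λ (jetLift φ r j)).compContinuousLinearMap
    (mfderiv (𝓡 (p + q)) (𝓡 (p + q)) φ j.1)

/-- `φ` preserves the orientation given by `v`. -/
def PreservesOrientation (v : VolumeForm (p + q) M) (φ : M ≃ₘ⟮𝓡 (p + q), 𝓡 (p + q)⟯ M) : Prop :=
  ∀ x, ∃ c > (0 : ℝ), (v.form (φ x)).compContinuousLinearMap
    (mfderiv (𝓡 (p + q)) (𝓡 (p + q)) φ x) = c • v.form x

/-- `φ` reverses the orientation given by `v`. -/
def ReversesOrientation (v : VolumeForm (p + q) M) (φ : M ≃ₘ⟮𝓡 (p + q), 𝓡 (p + q)⟯ M) : Prop :=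
  ∀ x, ∃ c < (0 : ℝ), (v.form (φ x)).compContinuousLinearMap
    (mfderiv (𝓡 (p + q)) (𝓡 (p + q)) φ x) = c • v.form x

end JetSpaces

end EHLagrangian

end

open EHLagrangian

/-!
# Naturality of the Einstein–Hilbert Lagrangian with a background connection

Everything is reduced to one statement in coordinates. Let `χ` be the expression of `φ⁻¹` in the
preferred charts at `φ x` and `x`, and `P` its differential. In these charts the metric `φ · g` is
the pullback of `g` along `χ`, and the Christoffel symbols `Γ'` of `D` and
`Γ` of `φ⁻¹ · D` are related by `P Γ'(a, b) = Γ(P a, P b) + χ''(a, b)`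
(`connectionSymbols_related`, which follows from the Leibniz rule). The Koszul
formula gives the same rule for the Levi-Civita connections (`leviCivita_related`). Hence the difference `T` of the two connections is a tensor; its covariant
derivative and the curvature are tensors as well (`nablaTensor_related`, `curvature_related`, the
latter by the symmetry of `χ'''`). Contractions do not depend on the basis
(`sum_basis_invariant`), so that the scalar curvature and `L'` are natural.

The sum `s^g + L'` has order one. It contains the derivatives of the Christoffel symbols `A` of `g`
only through a contraction of `g^{ik} (∂ₖ A^j_{ij} - ∂ᵢ A^j_{jk})`, which vanishes because `A` and
the inverse metric are symmetric (`scalarCurvature_add_lagrangianPrimeCoord`).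
The derivatives of the Christoffel symbols of `D` make sense because `D` is smooth
(`contDiffAt_connectionSymbols`).

Finally `φ^* v = c v` for a continuous nowhere vanishing function `c`, the `jacobian`, which has
constant sign as `M` is connected. The change of variables formula for determinants says that the
density of the volume form of `φ · g` is the one of `g` divided by `|c|` (`jetRho_jetLift`), so the
pullback of the Lagrangian density picks up the factor `c / |c| = ±1`.
-/

noncomputable section

namespace EHLagrangian

/-! ### Changes of coordinates -/

section CoordinateChange

variable {n : ℕ} {χ : Model n → Model n} {u : Model n}

theorem sum_coord_smul_stdVec (v : Model n) : ∑ i, v i • stdVec i = v := by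
  ext k
  simp [Pi.single_apply]

theorem contDiffAt_fderiv (hχ : ContDiffAt ℝ ∞ χ u) : ContDiffAt ℝ ∞ (fderiv ℝ χ) u :=
  hχ.fderiv_right (m := ∞) (by simp)

theorem differentiableAt_fderiv (hχ : ContDiffAt ℝ ∞ χ u) : DifferentiableAt ℝ (fderiv ℝ χ) u :=
  (contDiffAt_fderiv hχ).differentiableAt (by simp)

theorem fderiv_fderiv_symm (hχ : ContDiffAt ℝ ∞ χ u) (a b : Model n) :
    fderiv ℝ (fderiv ℝ χ) u a b = fderiv ℝ (fderiv ℝ χ) u b a :=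
  (hχ.isSymmSndFDerivAt (by simpa using ENat.LEInfty.out)).eq a b

/-- The third derivative of `χ` is symmetric in its first two arguments. -/
theorem fderiv_fderiv_fderiv_symm (hχ : ContDiffAt ℝ ∞ χ u) (a b c : Model n) :
    fderiv ℝ (fderiv ℝ (fderiv ℝ χ)) u a b c = fderiv ℝ (fderiv ℝ (fderiv ℝ χ)) u b a c := by
  rw [((contDiffAt_fderiv hχ).isSymmSndFDerivAt (by simpa using ENat.LEInfty.out)).eq a b]

theorem fderiv_apply_apply {F₁ F₂ F₃ : Type*} [NormedAddCommGroup F₁] [NormedSpace ℝ F₁]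
    [NormedAddCommGroup F₂] [NormedSpace ℝ F₂] [NormedAddCommGroup F₃] [NormedSpace ℝ F₃]
    {K : Model n → F₁ →L[ℝ] F₂ →L[ℝ] F₃} (hK : DifferentiableAt ℝ K u) (a : F₁) (b : F₂)
    (c : Model n) : fderiv ℝ (fun w ↦ K w a b) u c = fderiv ℝ K u c a b := by
  have h := (hK.hasFDerivAt.clm_apply (hasFDerivAt_const a u)).clm_apply (hasFDerivAt_const b u)
  rw [h.fderiv]
  simp

/-- The product rule for a bilinear field evaluated on the images of two constant vectors. -/
theorem fderiv_bilinear_comp {F : Type*} [NormedAddCommGroup F] [NormedSpace ℝ F]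
    {K : Model n → Model n →L[ℝ] Model n →L[ℝ] F} (hK : DifferentiableAt ℝ K (χ u))
    (hχ : ContDiffAt ℝ ∞ χ u) (a b c : Model n) :
    fderiv ℝ (fun w ↦ K (χ w) (fderiv ℝ χ w a) (fderiv ℝ χ w b)) u c =
      fderiv ℝ K (χ u) (fderiv ℝ χ u c) (fderiv ℝ χ u a) (fderiv ℝ χ u b) +
        K (χ u) (fderiv ℝ (fderiv ℝ χ) u c a) (fderiv ℝ χ u b) +
        K (χ u) (fderiv ℝ χ u a) (fderiv ℝ (fderiv ℝ χ) u c b) := by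
  have hP := (differentiableAt_fderiv hχ).hasFDerivAt
  have hK' := hK.hasFDerivAt.comp u (hχ.differentiableAt (by simp)).hasFDerivAt
  have h := (hK'.clm_apply (hP.clm_apply (hasFDerivAt_const a u))).clm_apply
    (hP.clm_apply (hasFDerivAt_const b u))
  rw [show fderiv ℝ (fun w ↦ K (χ w) (fderiv ℝ χ w a) (fderiv ℝ χ w b)) u = _ from h.fderiv]
  simp
  abel

theorem fderiv_apply_bilinear {K : Model n → Model n →L[ℝ] Model n →L[ℝ] Model n}
    (hK : DifferentiableAt ℝ K u) (hχ : ContDiffAt ℝ ∞ χ u) (a b c : Model n) :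
    fderiv ℝ (fun w ↦ fderiv ℝ χ w (K w a b)) u c =
      fderiv ℝ (fderiv ℝ χ) u c (K u a b) + fderiv ℝ χ u (fderiv ℝ K u c a b) := by
  have hP := (differentiableAt_fderiv hχ).hasFDerivAt
  have h := hP.clm_apply
    ((hK.hasFDerivAt.clm_apply (hasFDerivAt_const a u)).clm_apply (hasFDerivAt_const b u))
  rw [h.fderiv]
  simp
  abel

/-- `Γ'` are the Christoffel symbols at `u` of the linear connection whose Christoffel symbols
are `Γ`, after the change of coordinates `χ`. -/
def SymbolsRelated (χ : Model n → Model n)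
    (Γ Γ' : Model n → Model n →L[ℝ] Model n →L[ℝ] Model n) (u : Model n) : Prop :=
  ∀ a b, fderiv ℝ χ u (Γ' u a b) =
    Γ (χ u) (fderiv ℝ χ u a) (fderiv ℝ χ u b) + fderiv ℝ (fderiv ℝ χ) u a b

/-- `T'` is at `u` the pullback along `χ` of the vector valued bilinear form `T`. -/
def TensorRelated (χ : Model n → Model n)
    (T T' : Model n → Model n →L[ℝ] Model n →L[ℝ] Model n) (u : Model n) : Prop :=
  ∀ a b, fderiv ℝ χ u (T' u a b) = T (χ u) (fderiv ℝ χ u a) (fderiv ℝ χ u b)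

theorem SymbolsRelated.sub {Γ₁ Γ₂ Γ₁' Γ₂' : Model n → Model n →L[ℝ] Model n →L[ℝ] Model n}
    (h₁ : SymbolsRelated χ Γ₁ Γ₁' u) (h₂ : SymbolsRelated χ Γ₂ Γ₂' u) :
    TensorRelated χ (fun w ↦ Γ₁ w - Γ₂ w) (fun w ↦ Γ₁' w - Γ₂' w) u := by
  intro a b
  simp only [sub_apply, map_sub, h₁ a b, h₂ a b]
  abel

/-- The covariant derivative of a tensor field is a tensor field. -/
theorem nablaTensor_related {Γ Γ' T T' : Model n → Model n →L[ℝ] Model n →L[ℝ] Model n}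
    (hχ : ContDiffAt ℝ ∞ χ u) (hΓ : SymbolsRelated χ Γ Γ' u)
    (hT : ∀ᶠ w in 𝓝 u, TensorRelated χ T T' w) (hTd : DifferentiableAt ℝ T (χ u))
    (hTd' : DifferentiableAt ℝ T' u) (a b c : Model n) :
    fderiv ℝ χ u (nablaTensor Γ' T' u a b c) =
      nablaTensor Γ T (χ u) (fderiv ℝ χ u a) (fderiv ℝ χ u b) (fderiv ℝ χ u c) := by
  have hT₀ : TensorRelated χ T T' u := hT.self_of_nhds
  have hd : (fun w ↦ fderiv ℝ χ w (T' w a b)) =ᶠ[𝓝 u]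
      fun w ↦ T (χ w) (fderiv ℝ χ w a) (fderiv ℝ χ w b) := hT.mono fun w hw ↦ hw a b
  have hd := DFunLike.congr_fun (hd.fderiv_eq (𝕜 := ℝ)) c
  simp only [fderiv_apply_bilinear hTd' hχ, fderiv_bilinear_comp hTd hχ] at hd
  have hd' := eq_sub_of_add_eq' hd
  simp only [nablaTensor, map_add, map_sub, hT₀ _ _, hΓ _ _, hd', add_apply]
  abel

/-- The curvature is a tensor field. -/
theorem curvature_related {Γ Γ' : Model n → Model n →L[ℝ] Model n →L[ℝ] Model n}
    (hχ : ContDiffAt ℝ ∞ χ u) (hΓ : ∀ᶠ w in 𝓝 u, SymbolsRelated χ Γ Γ' w)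
    (hΓd : DifferentiableAt ℝ Γ (χ u)) (hΓd' : DifferentiableAt ℝ Γ' u) (a b c : Model n) :
    fderiv ℝ χ u (curvature Γ' u a b c) =
      curvature Γ (χ u) (fderiv ℝ χ u a) (fderiv ℝ χ u b) (fderiv ℝ χ u c) := by
  have hΓ₀ : SymbolsRelated χ Γ Γ' u := hΓ.self_of_nhds
  have key (a b c : Model n) : fderiv ℝ χ u (fderiv ℝ Γ' u a b c) =
      fderiv ℝ Γ (χ u) (fderiv ℝ χ u a) (fderiv ℝ χ u b) (fderiv ℝ χ u c) +
        Γ (χ u) (fderiv ℝ (fderiv ℝ χ) u a b) (fderiv ℝ χ u c) +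
        Γ (χ u) (fderiv ℝ χ u b) (fderiv ℝ (fderiv ℝ χ) u a c) +
        fderiv ℝ (fderiv ℝ (fderiv ℝ χ)) u a b c - fderiv ℝ (fderiv ℝ χ) u a (Γ' u b c) := by
    have hd : (fun w ↦ fderiv ℝ χ w (Γ' w b c)) =ᶠ[𝓝 u]
        fun w ↦ Γ (χ w) (fderiv ℝ χ w b) (fderiv ℝ χ w c) + fderiv ℝ (fderiv ℝ χ) w b c :=
      hΓ.mono fun w hw ↦ hw b c
    have hP := differentiableAt_fderiv hχ
    have hH : DifferentiableAt ℝ (fderiv ℝ (fderiv ℝ χ)) u :=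
      ((contDiffAt_fderiv hχ).fderiv_right (m := ∞) (by simp)).differentiableAt (by simp)
    have hd1 : DifferentiableAt ℝ (fun w ↦ Γ (χ w) (fderiv ℝ χ w b) (fderiv ℝ χ w c)) u :=
      ((hΓd.comp u (hχ.differentiableAt (by simp))).clm_apply
        (hP.clm_apply (differentiableAt_const b))).clm_apply
        (hP.clm_apply (differentiableAt_const c))
    have hd2 : DifferentiableAt ℝ (fun w ↦ fderiv ℝ (fderiv ℝ χ) w b c) u :=
      (hH.clm_apply (differentiableAt_const b)).clm_apply (differentiableAt_const c)
    have hd := DFunLike.congr_fun (hd.fderiv_eq (𝕜 := ℝ)) a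
    simp only [fderiv_apply_bilinear hΓd' hχ, fderiv_fun_add hd1 hd2, add_apply,
      fderiv_bilinear_comp hΓd hχ, fderiv_apply_apply hH] at hd
    rw [eq_sub_of_add_eq' hd]
  simp only [curvature, map_add, map_sub, key, hΓ₀ _ _,
    fderiv_fderiv_fderiv_symm hχ b a, fderiv_fderiv_symm hχ b a]
  abel

/-- The pairing `∑ f(eᵢ, eⁱ)` of a basis with its dual basis does not depend on the basis. -/
theorem sum_basis_invariant {f : Model n → (Model n →L[ℝ] ℝ) → ℝ}
    (hf₁ : ∀ α, IsLinearMap ℝ fun a ↦ f a α) (hf₂ : ∀ a, IsLinearMap ℝ (f a))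
    {P Q : Model n →L[ℝ] Model n} (h : ∀ a, P (Q a) = a) :
    ∑ i, f (P (stdVec i)) (stdCovec i ∘L Q) = ∑ i, f (stdVec i) (stdCovec i) := by
  have hcov (α : Model n →L[ℝ] ℝ) : α = ∑ l, α (stdVec l) • stdCovec l := by
    ext v
    conv_lhs => rw [← sum_coord_smul_stdVec v]
    simp [mul_comm]
  let F : Model n →ₗ[ℝ] (Model n →L[ℝ] ℝ) →ₗ[ℝ] ℝ :=
    LinearMap.mk₂ ℝ f (fun a b α ↦ (hf₁ α).map_add a b) (fun c a α ↦ (hf₁ α).map_smul c a)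
      (fun a ↦ (hf₂ a).map_add) (fun c a ↦ (hf₂ a).map_smul c)
  change ∑ i, F (P (stdVec i)) (stdCovec i ∘L Q) = ∑ i, F (stdVec i) (stdCovec i)
  have (i : Fin n) : F (P (stdVec i)) (stdCovec i ∘L Q) =
      ∑ l, F (Q (stdVec l) i • P (stdVec i)) (stdCovec l) := by
    rw [hcov (stdCovec i ∘L Q)]
    simp
  simp only [this]
  rw [Finset.sum_comm]
  refine Finset.sum_congr rfl fun l _ ↦ ?_
  rw [← LinearMap.sum_apply, ← map_sum]
  simp only [← map_smul]
  rw [← map_sum, sum_coord_smul_stdVec, h]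

/-- Conjugate linear maps have the same trace. -/
theorem trace_related {W W' : Model n → Model n} (hW : IsLinearMap ℝ W)
    {P : Model n →L[ℝ] Model n} (hP : P.IsInvertible) (h : ∀ a, P (W' a) = W (P a)) :
    ∑ j, stdCovec j (W' (stdVec j)) = ∑ j, stdCovec j (W (stdVec j)) := by
  obtain ⟨e, rfl⟩ := hP
  rw [← sum_basis_invariant (f := fun a α ↦ α (W a)) (P := e) (Q := e.symm)]
  · refine Finset.sum_congr rfl fun j _ ↦ ?_
    rw [← h]
    simp
  · exact fun α ↦ ⟨fun a b ↦ by rw [hW.map_add, map_add], fun c a ↦ by rw [hW.map_smul, map_smul]⟩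
  · exact fun a ↦ ⟨fun _ _ ↦ rfl, fun _ _ ↦ rfl⟩
  · simp

end CoordinateChange

/-! ### Naturality of the Levi-Civita connection and of the contractions -/

section CoordinateMetric

variable {n : ℕ} {χ : Model n → Model n} {u : Model n}
  {G : Model n → Model n →L[ℝ] Model n →L[ℝ] ℝ}

theorem apply_sharp {b : Model n →L[ℝ] Model n →L[ℝ] ℝ} (hb : b.IsInvertible)
    (α : Model n →L[ℝ] ℝ) : b (sharp b α) = α := by
  obtain ⟨e, rfl⟩ := hb
  simp [sharp]

theorem sharp_apply {b : Model n →L[ℝ] Model n →L[ℝ] ℝ} (hb : b.IsInvertible)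
    (v : Model n) : sharp b (b v) = v := by
  obtain ⟨e, rfl⟩ := hb
  simp [sharp]

theorem isInvertible_pullForm {b : Model n →L[ℝ] Model n →L[ℝ] ℝ} (hb : b.IsInvertible)
    {P : Model n →L[ℝ] Model n} (hP : P.IsInvertible) : (pullForm b P).IsInvertible := by
  obtain ⟨e, rfl⟩ := hP
  apply isInvertible_of_injective
  rw [injective_iff_map_eq_zero]
  intro v hv
  have : b (e v) = 0 := by
    ext w
    simpa using congrArg (fun α ↦ α (e.symm w)) hv
  obtain ⟨e', rfl⟩ := hb
  simpa using this

/-- The musical isomorphism is natural. -/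
theorem apply_sharp_pullForm {b : Model n →L[ℝ] Model n →L[ℝ] ℝ} (hb : b.IsInvertible)
    {P : Model n →L[ℝ] Model n} (hP : P.IsInvertible) (α : Model n →L[ℝ] ℝ) :
    P (sharp (pullForm b P) α) = sharp b (α ∘L P.inverse) := by
  have h := apply_sharp (isInvertible_pullForm hb hP) α
  rw [← sharp_apply hb (P (sharp (pullForm b P) α))]
  congr 1
  obtain ⟨e, rfl⟩ := hP
  ext w
  have := congrArg (fun β ↦ β (e.symm w)) h
  simpa using this

theorem apply_leviCivita {w : Model n} (hi : (G w).IsInvertible) (a b c : Model n) :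
    G w (leviCivita G w a b) c = (1 / 2 : ℝ) * koszul (fderiv ℝ G w) a b c := by
  rw [leviCivita_apply, map_smul, apply_sharp hi]
  simp

theorem fderiv_symm (hd : DifferentiableAt ℝ G u) (hs : ∀ᶠ w in 𝓝 u, ∀ a b, G w a b = G w b a)
    (a b c : Model n) : fderiv ℝ G u a b c = fderiv ℝ G u a c b := by
  have h : (fun w ↦ G w b c) =ᶠ[𝓝 u] fun w ↦ G w c b := hs.mono fun w hw ↦ hw b c
  have h := DFunLike.congr_fun (h.fderiv_eq (𝕜 := ℝ)) a
  simpa only [fderiv_apply_apply hd] using h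

theorem leviCivita_symm (hd : DifferentiableAt ℝ G u)
    (hs : ∀ᶠ w in 𝓝 u, ∀ a b, G w a b = G w b a) (a b : Model n) :
    leviCivita G u a b = leviCivita G u b a := by
  rw [leviCivita_apply, leviCivita_apply]
  congr 2
  ext c
  simp only [koszul_apply, fderiv_symm hd hs c a b]
  ring

theorem differentiableAt_leviCivita (hG : ContDiffAt ℝ ∞ G u) (hi : (G u).IsInvertible) :
    DifferentiableAt ℝ (leviCivita G) u := (hasFDerivAt_leviCivita hG hi).differentiableAt

/-- The Levi-Civita connection is natural: by the Koszul formula both sides have the same scalar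
products with all vectors. -/
theorem leviCivita_related (hχ : ContDiffAt ℝ ∞ χ u) (hP : (fderiv ℝ χ u).IsInvertible)
    (hd : ContDiffAt ℝ ∞ G (χ u)) (hs : ∀ᶠ w in 𝓝 (χ u), ∀ a b, G w a b = G w b a)
    (hi : (G (χ u)).IsInvertible) :
    SymbolsRelated χ (leviCivita G) (leviCivita (pullMetric χ G)) u := by
  intro a b
  have hGd : DifferentiableAt ℝ G (χ u) := hd.differentiableAt (by simp)
  have hpull (a b c : Model n) : fderiv ℝ (pullMetric χ G) u a b c = _ :=
    calc
      _ = fderiv ℝ (fun w ↦ pullMetric χ G w b c) u a := by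
        refine (fderiv_apply_apply ?_ b c a).symm
        rw [pullMetric_eq]
        have hP := differentiableAt_fderiv hχ
        have hGχ := hGd.comp u (hχ.differentiableAt (by simp))
        exact ((ContinuousLinearMap.differentiableAt _).comp u
          (((ContinuousLinearMap.differentiableAt _).comp u hGχ).clm_apply hP)).clm_apply
          ((ContinuousLinearMap.differentiableAt _).comp u hP)
      _ = _ := fderiv_bilinear_comp hGd hχ b c a
  have hinj : Function.Injective (G (χ u)) := by
    obtain ⟨e, he⟩ := hi
    rw [← he]
    exact e.injective
  apply hinj
  ext c'
  obtain ⟨c, rfl⟩ : ∃ c, fderiv ℝ χ u c = c' := by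
    obtain ⟨e, he⟩ := hP
    exact ⟨e.symm c', by rw [← he]; simp⟩
  have hL := apply_leviCivita (G := pullMetric χ G) (isInvertible_pullForm hi hP) a b c
  simp only [pullMetric, pullForm_apply] at hL
  rw [map_add, add_apply, apply_leviCivita hi, hL]
  have hs₀ := hs.self_of_nhds
  simp only [koszul_apply]
  simp only [hpull, fderiv_fderiv_symm hχ b a, fderiv_fderiv_symm hχ c a,
    fderiv_fderiv_symm hχ c b, hs₀ (fderiv ℝ χ u b) (fderiv ℝ (fderiv ℝ χ) u a c),
    hs₀ (fderiv ℝ χ u a) (fderiv ℝ (fderiv ℝ χ) u b c)]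
  ring

end CoordinateMetric

section Naturality

variable {n : ℕ} {χ : Model n → Model n} {u : Model n}
  {G G' : Model n → Model n →L[ℝ] Model n →L[ℝ] ℝ}

theorem isLinearMap_curvature (Γ : Model n → Model n →L[ℝ] Model n →L[ℝ] Model n)
    (u b c : Model n) : IsLinearMap ℝ fun a ↦ curvature Γ u a b c :=
  ⟨fun x y ↦ by simp only [curvature, map_add, add_apply]; abel,
    fun r x ↦ by simp only [curvature, map_smul, smul_apply]; module⟩

theorem isLinearMap_ricci_left (Γ : Model n → Model n →L[ℝ] Model n →L[ℝ] Model n)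
    (u b : Model n) : IsLinearMap ℝ fun a ↦ ricci Γ u a b :=
  ⟨fun x y ↦ by
    simp only [ricci, ← Finset.sum_add_distrib, ← map_add]
    refine Finset.sum_congr rfl fun j _ ↦ congrArg _ ?_
    simp only [curvature, map_add, add_apply]; abel,
    fun r x ↦ by
    simp only [ricci, Finset.smul_sum, ← map_smul]
    refine Finset.sum_congr rfl fun j _ ↦ congrArg _ ?_
    simp only [curvature, map_smul, smul_apply]; module⟩

theorem isLinearMap_ricci_right (Γ : Model n → Model n →L[ℝ] Model n →L[ℝ] Model n)
    (u a : Model n) : IsLinearMap ℝ fun b ↦ ricci Γ u a b :=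
  ⟨fun x y ↦ by
    simp only [ricci, ← Finset.sum_add_distrib, ← map_add]
    refine Finset.sum_congr rfl fun j _ ↦ congrArg _ ?_
    simp only [curvature, map_add]; abel,
    fun r x ↦ by
    simp only [ricci, Finset.smul_sum, ← map_smul]
    refine Finset.sum_congr rfl fun j _ ↦ congrArg _ ?_
    simp only [curvature, map_smul]; module⟩

/-- `G` is a smooth pseudo-Riemannian metric near `u`. -/
structure IsMetricNear (G : Model n → Model n →L[ℝ] Model n →L[ℝ] ℝ) (u : Model n) : Prop where
  smooth : ∀ᶠ w in 𝓝 u, ContDiffAt ℝ ∞ G w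
  symm : ∀ᶠ w in 𝓝 u, ∀ a b, G w a b = G w b a
  invertible : ∀ᶠ w in 𝓝 u, (G w).IsInvertible

/-- `χ` is a smooth change of coordinates near `u`. -/
structure IsCoordChangeNear (χ : Model n → Model n) (u : Model n) : Prop where
  smooth : ∀ᶠ w in 𝓝 u, ContDiffAt ℝ ∞ χ w
  invertible : ∀ᶠ w in 𝓝 u, (fderiv ℝ χ w).IsInvertible

theorem IsMetricNear.differentiableAt (h : IsMetricNear G u) :
    DifferentiableAt ℝ (leviCivita G) u :=
  differentiableAt_leviCivita h.smooth.self_of_nhds h.invertible.self_of_nhds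

theorem IsMetricNear.leviCivita_symm (h : IsMetricNear G u) :
    ∀ᶠ w in 𝓝 u, ∀ a b, leviCivita G w a b = leviCivita G w b a := by
  filter_upwards [h.smooth, h.symm.eventually_nhds] with w hw hw'
  exact EHLagrangian.leviCivita_symm (hw.differentiableAt (by simp)) hw'

theorem IsCoordChangeNear.tendsto (h : IsCoordChangeNear χ u) :
    Filter.Tendsto χ (𝓝 u) (𝓝 (χ u)) :=
  h.smooth.self_of_nhds.continuousAt

theorem IsMetricNear.pull (h : IsMetricNear G (χ u)) (hχ : IsCoordChangeNear χ u) :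
    IsMetricNear (pullMetric χ G) u where
  smooth := by
    filter_upwards [hχ.tendsto.eventually h.smooth, hχ.smooth] with w hG hw
    rw [pullMetric_eq]
    have hP := contDiffAt_fderiv hw
    exact ((ContinuousLinearMap.contDiff _).contDiffAt.comp w
      (((ContinuousLinearMap.contDiff _).contDiffAt.comp w (hG.comp w hw)).clm_apply hP)).clm_apply
      ((ContinuousLinearMap.contDiff _).contDiffAt.comp w hP)
  symm := by
    filter_upwards [hχ.tendsto.eventually h.symm] with w hw a b
    exact hw _ _
  invertible := by
    filter_upwards [hχ.tendsto.eventually h.invertible, hχ.invertible] with w hG hw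
    exact isInvertible_pullForm hG hw

theorem leviCivita_related_near (h : IsMetricNear G (χ u)) (hχ : IsCoordChangeNear χ u) :
    ∀ᶠ w in 𝓝 u, SymbolsRelated χ (leviCivita G) (leviCivita (pullMetric χ G)) w := by
  filter_upwards [hχ.smooth, hχ.invertible, hχ.tendsto.eventually h.smooth,
    hχ.tendsto.eventually h.symm.eventually_nhds, hχ.tendsto.eventually h.invertible]
    with w h₁ h₂ h₃ h₄ h₅
  exact leviCivita_related h₁ h₂ h₃ h₄ h₅

/-- The scalar curvature is natural. -/
theorem scalarCurvature_pullMetric (h : IsMetricNear G (χ u)) (hχ : IsCoordChangeNear χ u) :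
    scalarCurvature (pullMetric χ G) u = scalarCurvature G (χ u) := by
  have hP := hχ.invertible.self_of_nhds
  have hR := curvature_related hχ.smooth.self_of_nhds (leviCivita_related_near h hχ)
    h.differentiableAt (h.pull hχ).differentiableAt
  have hric (a b : Model n) : ricci (leviCivita (pullMetric χ G)) u a b =
      ricci (leviCivita G) (χ u) (fderiv ℝ χ u a) (fderiv ℝ χ u b) :=
    trace_related (isLinearMap_curvature _ _ _ _) hP fun z ↦ hR z a b
  have hsharp := apply_sharp_pullForm h.invertible.self_of_nhds hP
  simp only [scalarCurvature, hric, pullMetric, hsharp]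
  refine sum_basis_invariant
    (f := fun a α ↦ ricci (leviCivita G) (χ u) a (sharp (G (χ u)) α)) ?_ ?_ ?_
  · exact fun α ↦ isLinearMap_ricci_left _ _ _
  · intro a
    have := isLinearMap_ricci_right (leviCivita G) (χ u) a
    exact ⟨fun α β ↦ by rw [map_add, this.map_add], fun c α ↦ by rw [map_smul, this.map_smul]⟩
  · obtain ⟨e, he⟩ := hP
    simp [← he]

variable {Γ Γ' : Model n → Model n →L[ℝ] Model n →L[ℝ] Model n}

/-- The contraction `c((alt₂₃ (∇^G T))♯)` is natural. -/
theorem lagrangianPrimeCoord_pullMetric (h : IsMetricNear G (χ u)) (hχ : IsCoordChangeNear χ u)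
    (hΓ : ∀ᶠ w in 𝓝 u, SymbolsRelated χ Γ Γ' w) (hΓd : DifferentiableAt ℝ Γ (χ u))
    (hΓd' : DifferentiableAt ℝ Γ' u) :
    lagrangianPrimeCoord (pullMetric χ G) Γ' u = lagrangianPrimeCoord G Γ (χ u) := by
  have hP := hχ.invertible.self_of_nhds
  have hL := leviCivita_related_near h hχ
  set W := alt23 (nablaTensor (leviCivita G) (fun w ↦ leviCivita G w - Γ w) (χ u)) with hW
  set W' := alt23 (nablaTensor (leviCivita (pullMetric χ G))
    (fun w ↦ leviCivita (pullMetric χ G) w - Γ' w) u) with hW'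
  have hWW' (a b c : Model n) : fderiv ℝ χ u (W' a b c) =
      W (fderiv ℝ χ u a) (fderiv ℝ χ u b) (fderiv ℝ χ u c) := by
    have := nablaTensor_related hχ.smooth.self_of_nhds hL.self_of_nhds
      ((hL.and hΓ).mono fun w hw ↦ hw.1.sub hw.2) (h.differentiableAt.sub hΓd)
      ((h.pull hχ).differentiableAt.sub hΓd')
    rw [hW, hW']
    simp only [alt23, map_sub, this]
  have hlin₁ (b c : Model n) : IsLinearMap ℝ fun a ↦ W a b c :=
    ⟨fun x y ↦ by simp only [hW, alt23, nablaTensor, map_add, add_apply]; abel,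
      fun r x ↦ by simp only [hW, alt23, nablaTensor, map_smul, smul_apply]; module⟩
  have hlin₂ (a c : Model n) : IsLinearMap ℝ fun b ↦ W a b c :=
    ⟨fun x y ↦ by simp only [hW, alt23, nablaTensor, map_add, add_apply]; abel,
      fun r x ↦ by simp only [hW, alt23, nablaTensor, map_smul, smul_apply]; module⟩
  have hlin₃ (a b : Model n) : IsLinearMap ℝ fun c ↦ W a b c :=
    ⟨fun x y ↦ by simp only [hW, alt23, nablaTensor, map_add, add_apply]; abel,
      fun r x ↦ by simp only [hW, alt23, nablaTensor, map_smul, smul_apply]; module⟩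
  have htr (a c : Model n) : ∑ j, stdCovec j (W' a (stdVec j) c) =
      ∑ j, stdCovec j (W (fderiv ℝ χ u a) (stdVec j) (fderiv ℝ χ u c)) :=
    trace_related (W' := fun b ↦ W' a b c) (hlin₂ _ _) hP fun b ↦ hWW' a b c
  have hsharp := apply_sharp_pullForm h.invertible.self_of_nhds hP
  simp only [lagrangianPrimeCoord, totalContraction, raiseThird, ← hW, ← hW', htr, hsharp,
    pullMetric]
  refine sum_basis_invariant
    (f := fun a α ↦ ∑ j, stdCovec j (W a (stdVec j) (sharp (G (χ u)) α))) ?_ ?_ ?_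
  · intro α
    exact ⟨fun x y ↦ by simp only [(hlin₁ _ _).map_add, map_add, Finset.sum_add_distrib],
      fun r x ↦ by simp only [(hlin₁ _ _).map_smul, map_smul, Finset.smul_sum]⟩
  · intro a
    exact ⟨fun x y ↦ by simp only [(hlin₃ _ _).map_add, map_add, Finset.sum_add_distrib],
      fun r x ↦ by simp only [(hlin₃ _ _).map_smul, map_smul, Finset.smul_sum]⟩
  · obtain ⟨e, he⟩ := hP
    simp [← he]

/-! ### The first order property -/

/-- The inverse of a symmetric form is symmetric, so that it can be contracted with a bilinear map
in either order. -/
theorem sum_sharp_symm {b : Model n →L[ℝ] Model n →L[ℝ] ℝ} (hb : b.IsInvertible)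
    (hs : ∀ v w, b v w = b w v) {F : Type*} [NormedAddCommGroup F] [NormedSpace ℝ F]
    (B : Model n →L[ℝ] Model n →L[ℝ] F) :
    ∑ i, B (sharp b (stdCovec i)) (stdVec i) = ∑ i, B (stdVec i) (sharp b (stdCovec i)) := by
  have hsymm (i k : Fin n) : sharp b (stdCovec i) k = sharp b (stdCovec k) i := by
    have h1 := congrArg (fun α ↦ α (sharp b (stdCovec k))) (apply_sharp hb (stdCovec i))
    have h2 := congrArg (fun α ↦ α (sharp b (stdCovec i))) (apply_sharp hb (stdCovec k))
    simp only [EuclideanSpace.coe_proj] at h1 h2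
    rw [← h1, ← h2, hs]
  calc
    _ = ∑ i, ∑ k, sharp b (stdCovec i) k • B (stdVec k) (stdVec i) := by
      refine Finset.sum_congr rfl fun i _ ↦ ?_
      conv_lhs => rw [← sum_coord_smul_stdVec (sharp b (stdCovec i))]
      simp
    _ = ∑ i, ∑ k, sharp b (stdCovec i) k • B (stdVec i) (stdVec k) := by
      rw [Finset.sum_comm]
      simp only [hsymm]
    _ = _ := by
      refine Finset.sum_congr rfl fun i _ ↦ ?_
      conv_rhs => rw [← sum_coord_smul_stdVec (sharp b (stdCovec i))]
      simp

/-- In `s^G + c((alt₂₃ (∇^G T))♯)` the derivatives of the Christoffel symbols of `G` cancel, because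
these symbols and the inverse of `G` are symmetric; what remains has order one in `G`. -/
theorem scalarCurvature_add_lagrangianPrimeCoord (h : IsMetricNear G u)
    (hΓ : DifferentiableAt ℝ Γ u) :
    scalarCurvature G u + lagrangianPrimeCoord G Γ u =
      ∑ i, ∑ j, stdCovec j (
        leviCivita G u (stdVec j) (leviCivita G u (stdVec i) (sharp (G u) (stdCovec i))) -
        leviCivita G u (stdVec i) (leviCivita G u (stdVec j) (sharp (G u) (stdCovec i))) +
        alt23 (fun a b c ↦ leviCivita G u c (leviCivita G u a b - Γ u a b) -
          (leviCivita G u (leviCivita G u c a) b - Γ u (leviCivita G u c a) b) -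
          (leviCivita G u a (leviCivita G u c b) - Γ u a (leviCivita G u c b)) -
          fderiv ℝ Γ u c a b) (stdVec i) (stdVec j) (sharp (G u) (stdCovec i))) := by
  have hA := h.differentiableAt
  have hsymm (a b c : Model n) :
      fderiv ℝ (leviCivita G) u c a b = fderiv ℝ (leviCivita G) u c b a := by
    have hd : (fun w ↦ leviCivita G w a b) =ᶠ[𝓝 u] fun w ↦ leviCivita G w b a :=
      h.leviCivita_symm.mono fun w hw ↦ hw a b
    have hd := DFunLike.congr_fun (hd.fderiv_eq (𝕜 := ℝ)) c
    simpa only [fderiv_apply_apply hA] using hd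
  -- `∑ᵢ (∂_{♯eⁱ} A)(eᵢ, eⱼ) = ∑ᵢ (∂_{eᵢ} A)(eⱼ, ♯eⁱ)`
  have hcancel : ∑ i, ∑ j, stdCovec j
      (fderiv ℝ (leviCivita G) u (sharp (G u) (stdCovec i)) (stdVec i) (stdVec j) -
        fderiv ℝ (leviCivita G) u (stdVec i) (stdVec j) (sharp (G u) (stdCovec i))) = 0 := by
    rw [Finset.sum_comm]
    refine Finset.sum_eq_zero fun j _ ↦ ?_
    have := sum_sharp_symm h.invertible.self_of_nhds h.symm.self_of_nhds
      (((ContinuousLinearMap.compL ℝ (Model n) (Model n →L[ℝ] Model n) (Model n))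
        ((ContinuousLinearMap.apply ℝ (Model n) (stdVec j)))) ∘L fderiv ℝ (leviCivita G) u)
    simp only [ContinuousLinearMap.comp_apply, ContinuousLinearMap.compL_apply,
      ContinuousLinearMap.apply_apply] at this
    rw [← map_sum, Finset.sum_sub_distrib, this]
    simp only [hsymm (stdVec j)]
    simp
  rw [← add_zero (∑ i, ∑ j, _), ← hcancel]
  simp only [scalarCurvature, ricci, lagrangianPrimeCoord, totalContraction, raiseThird, curvature,
    alt23, nablaTensor, fderiv_fun_sub hA hΓ, ← Finset.sum_add_distrib, ← map_add, sub_apply]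
  refine Finset.sum_congr rfl fun i _ ↦ Finset.sum_congr rfl fun j _ ↦ congrArg _ ?_
  abel

theorem scalarCurvature_add_lagrangianPrimeCoord_congr (h : IsMetricNear G u)
    (h' : IsMetricNear G' u) (hΓ : DifferentiableAt ℝ Γ u) (hG : SameJet 1 G G' u) :
    scalarCurvature G u + lagrangianPrimeCoord G Γ u =
      scalarCurvature G' u + lagrangianPrimeCoord G' Γ u := by
  have h₁ : fderiv ℝ G u = fderiv ℝ G' u := by
    ext1 a
    have := congrArg (fun f ↦ f ![a]) (hG 1 le_rfl)
    simpa using this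
  have hL : leviCivita G u = leviCivita G' u := by
    simp only [leviCivita, hG.eq_zero, h₁]
  simp only [scalarCurvature_add_lagrangianPrimeCoord h hΓ,
    scalarCurvature_add_lagrangianPrimeCoord h' hΓ, hL, hG.eq_zero]

end Naturality

/-! ### Coordinate frames and diffeomorphisms -/

section Diffeomorphism

variable {n : ℕ} {M : Type*} [TopologicalSpace M] [ChartedSpace (Model n) M]
  (φ : M ≃ₘ⟮𝓡 n, 𝓡 n⟯ M) {x y : M}

theorem mem_coordDomain_of_mem (hy : y ∈ (extChartAt (𝓡 n) x).source)
    (hφy : φ y ∈ (extChartAt (𝓡 n) (φ x)).source) :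
    extChartAt (𝓡 n) (φ x) (φ y) ∈ coordDomain φ x := by
  refine ⟨(extChartAt (𝓡 n) (φ x)).map_source hφy, ?_⟩
  rw [Set.mem_preimage, Set.mem_preimage, (extChartAt (𝓡 n) (φ x)).left_inv hφy,
    φ.symm_apply_apply]
  exact hy

theorem coordInv_chart (hφy : φ y ∈ (extChartAt (𝓡 n) (φ x)).source) :
    coordInv φ x (extChartAt (𝓡 n) (φ x) (φ y)) = extChartAt (𝓡 n) x y := by
  rw [coordInv, (extChartAt (𝓡 n) (φ x)).left_inv hφy, φ.symm_apply_apply]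

theorem exists_of_mem_coordDomain {w : Model n} (hw : w ∈ coordDomain φ x) :
    ∃ y ∈ (extChartAt (𝓡 n) x).source, φ y ∈ (extChartAt (𝓡 n) (φ x)).source ∧
      extChartAt (𝓡 n) (φ x) (φ y) = w := by
  refine ⟨φ.symm ((extChartAt (𝓡 n) (φ x)).symm w), hw.2, ?_, ?_⟩
  · rw [φ.apply_symm_apply]
    exact (extChartAt (𝓡 n) (φ x)).map_target hw.1
  · rw [φ.apply_symm_apply, (extChartAt (𝓡 n) (φ x)).right_inv hw.1]

theorem continuousAt_volumeForm (v : VolumeForm n M) (x : M) :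
    ContinuousAt (fun y ↦ v.form y fun i ↦ chartFrame x y (stdVec i)) x := by
  have h1 : ContinuousAt (fun u ↦ v.form ((extChartAt (𝓡 n) x).symm u)
      fun i ↦ chartFrame x ((extChartAt (𝓡 n) x).symm u) (stdVec i)) (extChartAt (𝓡 n) x x) :=
    (v.smooth x).continuousOn.continuousAt (extChartAt_target_mem_nhds x)
  refine (h1.comp (continuousAt_extChartAt (I := 𝓡 n) x)).congr ?_
  filter_upwards [extChartAt_source_mem_nhds (I := 𝓡 n) x] with y hy
  simp only [Function.comp_apply]
  rw [(extChartAt (𝓡 n) x).left_inv hy]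

end Diffeomorphism

section Frames

variable {n : ℕ} {M : Type*} [TopologicalSpace M] [ChartedSpace (Model n) M]
  [IsManifold (𝓡 n) ∞ M]

theorem contMDiffAt_chartFrame {x y : M} (hy : y ∈ (extChartAt (𝓡 n) x).source) (a : Model n) :
    ContMDiffAt (𝓡 n) (𝓡 n).tangent ∞
      (fun z ↦ (⟨z, chartFrame x z a⟩ : TangentBundle (𝓡 n) M)) y := by
  have h : ContMDiffAt (𝓡 n) (𝓡 n).tangent ∞ (fun z ↦
      (⟨z, VectorField.mpullback (𝓡 n) (𝓡 n) (extChartAt (𝓡 n) x) (fun _ ↦ a) z⟩ :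
        TangentBundle (𝓡 n) M)) y := by
    refine ContMDiffAt.mpullback_vectorField_preimage (n := ∞) (m := ∞) ?_
      (contMDiffAt_extChartAt' (by simpa using hy)) (isInvertible_chart hy) (by simp)
    exact contMDiffAt_vectorSpace_iff_contDiffAt.2 contDiffAt_const
  exact h

theorem chart_chartFrame {x y : M} (hy : y ∈ (extChartAt (𝓡 n) x).source) (a : Model n) :
    mfderiv (𝓡 n) (𝓡 n) (extChartAt (𝓡 n) x) y (chartFrame x y a) = a := by
  obtain ⟨e, he⟩ := isInvertible_chart hy
  rw [chartFrame, ← he, ContinuousLinearMap.inverse_equiv]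
  exact e.apply_symm_apply a

theorem chartFrame_chart {x y : M} (hy : y ∈ (extChartAt (𝓡 n) x).source)
    (v : TangentSpace (𝓡 n) y) :
    chartFrame x y (mfderiv (𝓡 n) (𝓡 n) (extChartAt (𝓡 n) x) y v) = v := by
  obtain ⟨e, he⟩ := isInvertible_chart hy
  rw [chartFrame, ← he, ContinuousLinearMap.inverse_equiv]
  exact e.symm_apply_apply v

/-- A field of endomorphisms of the tangent spaces in the coordinates of the preferred chart. -/
def endInFrame (A : Π y : M, TangentSpace (𝓡 n) y →L[ℝ] TangentSpace (𝓡 n) y) (x y : M) :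
    Model n →L[ℝ] Model n :=
  mfderiv (𝓡 n) (𝓡 n) (extChartAt (𝓡 n) x) y ∘L A y ∘L chartFrame x y

theorem inCoordinates_tangent {x y : M} (hy : y ∈ (extChartAt (𝓡 n) x).source)
    (A : Π y : M, TangentSpace (𝓡 n) y →L[ℝ] TangentSpace (𝓡 n) y) :
    ContinuousLinearMap.inCoordinates (Model n) (TangentSpace (𝓡 n) : M → Type _) (Model n)
      (TangentSpace (𝓡 n) : M → Type _) x y x y (A y) = endInFrame A x y := by
  have hy' : y ∈ (chartAt (Model n) x).source := by simpa using hy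
  have h1 := TangentBundle.continuousLinearMapAt_trivializationAt (I := 𝓡 n) hy'
  have hb : y ∈ (trivializationAt (Model n) (TangentSpace (𝓡 n) : M → Type _) x).baseSet := by
    simpa using hy'
  have h2 (a : Model n) : (trivializationAt (Model n) (TangentSpace (𝓡 n) : M → Type _) x).symmL
      ℝ y a = chartFrame x y a := by
    have h3 := (trivializationAt (Model n)
      (TangentSpace (𝓡 n) : M → Type _) x).continuousLinearMapAt_symmL hb (R := ℝ) a
    rw [h1] at h3
    exact (chartFrame_chart hy _).symm.trans (congrArg (chartFrame x y) h3)
  rw [ContinuousLinearMap.inCoordinates, h1]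
  ext1 a
  exact congrArg (fun b ↦ mfderiv (𝓡 n) (𝓡 n) (extChartAt (𝓡 n) x) y (A y b)) (h2 a)

/-- A field of endomorphisms is smooth at `x` if and only if its matrix in the coordinate frame of
the preferred chart at `x` is. -/
theorem contMDiffAt_endomorphism {x : M}
    {A : Π y : M, TangentSpace (𝓡 n) y →L[ℝ] TangentSpace (𝓡 n) y} :
    ContMDiffAt (𝓡 n) ((𝓡 n).prod 𝓘(ℝ, Model n →L[ℝ] Model n)) ∞
      (fun y ↦ (⟨y, A y⟩ : Bundle.TotalSpace (Model n →L[ℝ] Model n)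
        fun y : M ↦ TangentSpace (𝓡 n) y →L[ℝ] TangentSpace (𝓡 n) y)) x ↔
    ContMDiffAt (𝓡 n) 𝓘(ℝ, Model n →L[ℝ] Model n) ∞ (endInFrame A x) x := by
  rw [contMDiffAt_hom_bundle]
  have : (fun y ↦ ContinuousLinearMap.inCoordinates (Model n)
      (TangentSpace (𝓡 n) : M → Type _) (Model n) (TangentSpace (𝓡 n) : M → Type _) x y x y (A y))
      =ᶠ[𝓝 x] endInFrame A x := by
    filter_upwards [extChartAt_source_mem_nhds (I := 𝓡 n) x] with y hy
    exact inCoordinates_tangent hy A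
  exact ⟨fun h ↦ h.2.congr_of_eventuallyEq this.symm,
    fun h ↦ ⟨contMDiffAt_id, h.congr_of_eventuallyEq this⟩⟩

theorem connectionSymbols_chart (D : Connection n M) {x y : M}
    (hy : y ∈ (extChartAt (𝓡 n) x).source) :
    connectionSymbols D x (extChartAt (𝓡 n) x y) =
      ∑ k, (ContinuousLinearMap.smulRightL ℝ (Model n) (Model n) (stdCovec k)) ∘L
        endInFrame (D fun z ↦ chartFrame x z (stdVec k)) x y := by
  have h := (extChartAt (𝓡 n) x).left_inv hy
  have key (k : Fin n) : endInFrame (D fun z ↦ chartFrame x z (stdVec k)) x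
      ((extChartAt (𝓡 n) x).symm (extChartAt (𝓡 n) x y)) =
      endInFrame (D fun z ↦ chartFrame x z (stdVec k)) x y := by rw [h]
  simp only [← key]
  rfl

/-- The Christoffel symbols of a smooth connection are smooth. As the connection acts on global
vector fields, the coordinate fields are first multiplied with a bump function. -/
theorem contDiffAt_connectionSymbols [T2Space M] {D : Connection n M}
    (hD : D.ContMDiffCovariantDerivative ∞) (x : M) :
    ContDiffAt ℝ ∞ (connectionSymbols D x) (extChartAt (𝓡 n) x x) := by
  have hend (k : Fin n) : ContMDiffAt (𝓡 n) 𝓘(ℝ, Model n →L[ℝ] Model n) ∞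
      (endInFrame (D fun z ↦ chartFrame x z (stdVec k)) x) x := by
    let f : SmoothBumpFunction (𝓡 n) x := Classical.choice inferInstance
    let σ : Π y : M, TangentSpace (𝓡 n) y := fun y ↦ f y • chartFrame x y (stdVec k)
    have hσ : ContMDiff (𝓡 n) (𝓡 n).tangent ∞ (fun y ↦ (⟨y, σ y⟩ : TangentBundle (𝓡 n) M)) := by
      refine ContMDiffOn.smul_section_of_tsupport (ψ := f) (V := (TangentSpace (𝓡 n) : M → Type _))
        (s := fun y ↦ chartFrame x y (stdVec k)) f.contMDiff.contMDiffOn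
        (isOpen_extChartAt_source (I := 𝓡 n) x) f.tsupport_subset_extChartAt_source ?_
      exact fun y hy ↦ (contMDiffAt_chartFrame hy _).contMDiffWithinAt
    have hDσ := hD.contMDiff.contMDiff (σ := σ) (by simpa using hσ.contMDiffOn)
    rw [contMDiffOn_univ] at hDσ
    refine (contMDiffAt_endomorphism.1 (hDσ x)).congr_of_eventuallyEq ?_
    filter_upwards [f.eventuallyEq_one.eventually_nhds,
      extChartAt_source_mem_nhds (I := 𝓡 n) x] with y hy hyx
    have : D (fun z ↦ chartFrame x z (stdVec k)) y = D σ y := by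
      refine D.isCovariantDerivativeOnUniv.congr_of_eventuallyEq
        ((contMDiffAt_chartFrame hyx _).mdifferentiableAt (by simp))
        ((hσ y).mdifferentiableAt (by simp)) Filter.univ_mem ?_
      filter_upwards [hy] with z hz
      simp [σ, hz]
    simp only [endInFrame]
    rw [this]
  have hsymm : ContMDiffAt (𝓡 n) (𝓡 n) ∞ (extChartAt (𝓡 n) x).symm (extChartAt (𝓡 n) x x) :=
    (contMDiffOn_extChartAt_symm x).contMDiffAt (extChartAt_target_mem_nhds x)
  have hcoord (k : Fin n) : ContDiffAt ℝ ∞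
      (endInFrame (D fun z ↦ chartFrame x z (stdVec k)) x ∘ (extChartAt (𝓡 n) x).symm)
      (extChartAt (𝓡 n) x x) := by
    rw [← contMDiffAt_iff_contDiffAt]
    refine ContMDiffAt.comp _ ?_ hsymm
    rw [extChartAt_to_inv]
    exact hend k
  exact ContDiffAt.sum fun k _ ↦ contDiffAt_const.clm_comp (hcoord k)

theorem covariantDerivative_sum_smul (D : Connection n M) {ι : Type*} (s : Finset ι)
    {F : ι → Π y : M, TangentSpace (𝓡 n) y} {g : ι → M → ℝ} {x : M}
    (hF : ∀ i, MDifferentiableAt (𝓡 n) (𝓡 n).tangent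
      (fun y ↦ (⟨y, F i y⟩ : TangentBundle (𝓡 n) M)) x)
    (hg : ∀ i, MDifferentiableAt (𝓡 n) 𝓘(ℝ, ℝ) (g i) x) :
    D (∑ i ∈ s, g i • F i) x =
      ∑ i ∈ s, (g i x • D (F i) x + (mvfderiv (𝓡 n) (g i) x).smulRight (F i x)) := by
  classical
  induction s using Finset.induction_on with
  | empty => simp
  | insert i s hi ih =>
    rw [Finset.sum_insert hi, Finset.sum_insert hi, ← ih,
      D.isCovariantDerivativeOnUniv.add ((hg i).smul_section (hF i)),
      D.isCovariantDerivativeOnUniv.leibniz (hF i) (hg i)]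
    have := MDifferentiableAt.sum_section (s := s) (t := fun i ↦ g i • F i)
      fun i _ ↦ (hg i).smul_section (hF i)
    convert this using 2
    simp

variable (φ : M ≃ₘ⟮𝓡 n, 𝓡 n⟯ M) {x y : M}

theorem mpullback_symm (Y : Π y : M, TangentSpace (𝓡 n) y) (y : M) :
    VectorField.mpullback (𝓡 n) (𝓡 n) φ.symm Y (φ y) = mfderiv (𝓡 n) (𝓡 n) φ y (Y y) := by
  have h := pullback_pullback φ.symm Y y
  exact ((isInvertible_diffeo φ y).inverse_apply_eq.1 h)

theorem mfderiv_pushConnection_symm (D : Connection n M) (Y : Π y : M, TangentSpace (𝓡 n) y)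
    (v : TangentSpace (𝓡 n) y) :
    mfderiv (𝓡 n) (𝓡 n) φ y (pushConnection φ.symm D Y y v) =
      D (VectorField.mpullback (𝓡 n) (𝓡 n) φ.symm Y) (φ y) (mfderiv (𝓡 n) (𝓡 n) φ y v) :=
  (isInvertible_diffeo φ y).self_apply_inverse _

/-- The coordinate fields at `φ x` are combinations of the images under `φ` of those at `x`, the
coefficients being the entries of the Jacobian matrix of `coordInv φ x`. -/
theorem chartFrame_apply {z : M} (hz : z ∈ (extChartAt (𝓡 n) (φ x)).source)
    (hz' : φ.symm z ∈ (extChartAt (𝓡 n) x).source) (a : Model n) :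
    chartFrame (φ x) z a = VectorField.mpullback (𝓡 n) (𝓡 n) φ.symm
      (fun y ↦ chartFrame x y (fderiv ℝ (coordInv φ x) (extChartAt (𝓡 n) (φ x) z) a)) z := by
  have h := DFunLike.congr_fun (fderiv_coordInv φ x hz hz') a
  exact ((isInvertible_diffeo φ.symm z).inverse_apply_eq.2 h.symm).symm

theorem chartFrame_apply_diffeo (hy : y ∈ (extChartAt (𝓡 n) x).source)
    (hφy : φ y ∈ (extChartAt (𝓡 n) (φ x)).source) (a : Model n) :
    chartFrame (φ x) (φ y) a = mfderiv (𝓡 n) (𝓡 n) φ y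
      (chartFrame x y (fderiv ℝ (coordInv φ x) (extChartAt (𝓡 n) (φ x) (φ y)) a)) := by
  rw [chartFrame_apply φ hφy (by rwa [φ.symm_apply_apply]) a]
  exact mpullback_symm φ _ y

theorem isInvertible_fderiv_coordInv (hy : y ∈ (extChartAt (𝓡 n) x).source)
    (hφy : φ y ∈ (extChartAt (𝓡 n) (φ x)).source) :
    (fderiv ℝ (coordInv φ x) (extChartAt (𝓡 n) (φ x) (φ y))).IsInvertible := by
  have h : fderiv ℝ (coordInv φ x) (extChartAt (𝓡 n) (φ x) (φ y)) =
      mfderiv (𝓡 n) (𝓡 n) (extChartAt (𝓡 n) x) y ∘L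
        (mfderiv (𝓡 n) (𝓡 n) φ y).inverse ∘L chartFrame (φ x) (φ y) := by
    ext1 a
    have h := (isInvertible_diffeo φ y).inverse_apply_eq.2 (chartFrame_apply_diffeo φ hy hφy a)
    exact ((congrArg (mfderiv (𝓡 n) (𝓡 n) (extChartAt (𝓡 n) x) y) h).trans
      (chart_chartFrame hy _)).symm
  rw [h]
  exact (isInvertible_chart hy).comp
    ((isInvertible_diffeo φ y).inverse.comp (isInvertible_chart hφy).inverse)

theorem fderiv_coordInv_chart (hy : y ∈ (extChartAt (𝓡 n) x).source)
    (hφy : φ y ∈ (extChartAt (𝓡 n) (φ x)).source) (v : TangentSpace (𝓡 n) y) :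
    fderiv ℝ (coordInv φ x) (extChartAt (𝓡 n) (φ x) (φ y))
      (mfderiv (𝓡 n) (𝓡 n) (extChartAt (𝓡 n) (φ x)) (φ y) (mfderiv (𝓡 n) (𝓡 n) φ y v)) =
      mfderiv (𝓡 n) (𝓡 n) (extChartAt (𝓡 n) x) y v := by
  obtain ⟨a, ha⟩ : ∃ a, fderiv ℝ (coordInv φ x) (extChartAt (𝓡 n) (φ x) (φ y)) a =
      mfderiv (𝓡 n) (𝓡 n) (extChartAt (𝓡 n) x) y v := by
    obtain ⟨e, he⟩ := isInvertible_fderiv_coordInv φ hy hφy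
    exact ⟨e.symm _, by rw [← he]; exact e.apply_symm_apply _⟩
  have h := chartFrame_apply_diffeo φ hy hφy a
  rw [ha, chartFrame_chart hy] at h
  rw [← h, chart_chartFrame hφy, ha]

end Frames

/-! ### Connections under diffeomorphisms -/

section ConnectionNaturality

variable {n : ℕ} {M : Type*} [TopologicalSpace M] [ChartedSpace (Model n) M]
  [IsManifold (𝓡 n) ∞ M] (φ : M ≃ₘ⟮𝓡 n, 𝓡 n⟯ M)

/-- The push-forward of the `i`-th coordinate field of the preferred chart at `x`. -/
def pushedFrame (x : M) (i : Fin n) : Π z : M, TangentSpace (𝓡 n) z :=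
  VectorField.mpullback (𝓡 n) (𝓡 n) φ.symm fun y ↦ chartFrame x y (stdVec i)

theorem mdifferentiableAt_pushedFrame {x y : M} (hy : y ∈ (extChartAt (𝓡 n) x).source)
    (i : Fin n) : MDifferentiableAt (𝓡 n) (𝓡 n).tangent
      (fun z ↦ (⟨z, pushedFrame φ x i z⟩ : TangentBundle (𝓡 n) M)) (φ y) := by
  refine MDifferentiableAt.mpullback_vectorField (n := ∞) ?_ φ.symm.contMDiffAt
    (isInvertible_diffeo φ.symm _) (by norm_cast)
  rw [φ.symm_apply_apply]
  exact (contMDiffAt_chartFrame hy _).mdifferentiableAt (by simp)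

/-- The transformation rule of the Christoffel symbols, by the Leibniz rule for the expansion of the
coordinate fields at `φ x` in terms of the images under `φ` of those at `x`. -/
theorem connectionSymbols_related (D : Connection n M) {x y : M}
    (hy : y ∈ (extChartAt (𝓡 n) x).source) (hφy : φ y ∈ (extChartAt (𝓡 n) (φ x)).source) :
    SymbolsRelated (coordInv φ x) (connectionSymbols (pushConnection φ.symm D) x)
      (connectionSymbols D (φ x)) (extChartAt (𝓡 n) (φ x) (φ y)) := by
  set u := extChartAt (𝓡 n) (φ x) (φ y) with hu
  set P := fderiv ℝ (coordInv φ x) with hP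
  have hχ : ContDiffAt ℝ ∞ (coordInv φ x) u := (contDiffOn_coordInv φ x).contDiffAt
    ((isOpen_coordDomain φ x).mem_nhds (mem_coordDomain_of_mem φ hy hφy))
  have hPd : DifferentiableAt ℝ P u := differentiableAt_fderiv hχ
  have hchart : MDifferentiableAt (𝓡 n) (𝓡 n) (extChartAt (𝓡 n) (φ x)) (φ y) :=
    mdifferentiableAt_extChartAt (by simpa using hφy)
  -- the coefficients of the expansion are the entries of the Jacobian matrix
  let c (k i : Fin n) (z : M) : ℝ := P (extChartAt (𝓡 n) (φ x) z) (stdVec k) i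
  have hc (k i : Fin n) : DifferentiableAt ℝ (fun w ↦ P w (stdVec k) i) u :=
    ((EuclideanSpace.proj (𝕜 := ℝ) i).differentiableAt).comp u
      (hPd.clm_apply (differentiableAt_const _))
  have hcM (k i : Fin n) : MDifferentiableAt (𝓡 n) 𝓘(ℝ, ℝ) (c k i) (φ y) :=
    (hc k i).mdifferentiableAt.comp (φ y) hchart
  have hcd (k i : Fin n) (a : Model n) : mvfderiv (𝓡 n) (c k i) (φ y)
      (chartFrame (φ x) (φ y) a) = fderiv ℝ P u a (stdVec k) i := by
    have h1 : mvfderiv (𝓡 n) (c k i) (φ y) = mvfderiv 𝓘(ℝ, Model n)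
        (fun w ↦ P w (stdVec k) i) u ∘L mfderiv (𝓡 n) (𝓡 n) (extChartAt (𝓡 n) (φ x)) (φ y) :=
      mvfderiv_comp (φ y) (hc k i).mdifferentiableAt hchart
    have h2 : fderiv ℝ (fun w ↦ P w (stdVec k) i) u a = fderiv ℝ P u a (stdVec k) i := by
      have := (EuclideanSpace.proj (𝕜 := ℝ) i).hasFDerivAt.comp u
        (hPd.hasFDerivAt.clm_apply (hasFDerivAt_const (stdVec k) u))
      rw [show fderiv ℝ (fun w ↦ P w (stdVec k) i) u = _ from this.fderiv]
      simp
    rw [h1, ContinuousLinearMap.comp_apply, chart_chartFrame hφy, ← h2]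
    simp only [mvfderiv, mfderiv_eq_fderiv]
    rfl
  have hexp (k : Fin n) : (D fun z ↦ chartFrame (φ x) z (stdVec k)) (φ y) =
      D (∑ i, c k i • pushedFrame φ x i) (φ y) := by
    refine D.isCovariantDerivativeOnUniv.congr_of_eventuallyEq
      ((contMDiffAt_chartFrame hφy _).mdifferentiableAt (by simp)) ?_ Filter.univ_mem ?_
    · have := MDifferentiableAt.sum_section (s := Finset.univ)
        (t := fun i ↦ c k i • pushedFrame φ x i)
        fun i _ ↦ (hcM k i).smul_section (mdifferentiableAt_pushedFrame φ hy i)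
      convert this using 2
      simp
    · filter_upwards [(isOpen_extChartAt_source (I := 𝓡 n) (φ x)).mem_nhds hφy,
        ((isOpen_extChartAt_source (I := 𝓡 n) x).preimage φ.symm.continuous).mem_nhds
          (show φ y ∈ φ.symm ⁻¹' _ by rwa [Set.mem_preimage, φ.symm_apply_apply])] with z hz hz'
      rw [chartFrame_apply φ hz hz', Finset.sum_apply]
      simp only [Pi.smul_apply', pushedFrame, VectorField.mpullback_apply, c]
      conv_lhs => rw [← sum_coord_smul_stdVec (fderiv ℝ (coordInv φ x) _ (stdVec k))]
      simp only [map_sum, map_smul]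
      rfl
  -- the rule for the second argument a basis vector
  have key (a : Model n) (k : Fin n) :
      P u (endInFrame (D fun z ↦ chartFrame (φ x) z (stdVec k)) (φ x) (φ y) a) =
      ∑ i, (P u (stdVec k) i • endInFrame
        (pushConnection φ.symm D fun z ↦ chartFrame x z (stdVec i)) x y (P u a)) +
      fderiv ℝ P u a (stdVec k) := by
    have h1 (i : Fin n) : D (pushedFrame φ x i) (φ y) (chartFrame (φ x) (φ y) a) =
        mfderiv (𝓡 n) (𝓡 n) φ y ((pushConnection φ.symm D fun z ↦ chartFrame x z (stdVec i)) y
          (chartFrame x y (P u a))) := by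
      rw [mfderiv_pushConnection_symm, chartFrame_apply_diffeo φ hy hφy]
      rfl
    have h2 (i : Fin n) : pushedFrame φ x i (φ y) =
        mfderiv (𝓡 n) (𝓡 n) φ y (chartFrame x y (stdVec i)) := mpullback_symm φ _ y
    have h3 : D (fun z ↦ chartFrame (φ x) z (stdVec k)) (φ y) (chartFrame (φ x) (φ y) a) =
        mfderiv (𝓡 n) (𝓡 n) φ y (∑ i, (P u (stdVec k) i •
          (pushConnection φ.symm D fun z ↦ chartFrame x z (stdVec i)) y (chartFrame x y (P u a)) +
          fderiv ℝ P u a (stdVec k) i • chartFrame x y (stdVec i))) := by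
      rw [hexp, covariantDerivative_sum_smul D _
        (fun i ↦ mdifferentiableAt_pushedFrame φ hy i) (hcM k), sum_apply, map_sum]
      refine Finset.sum_congr rfl fun i _ ↦ ?_
      rw [add_apply, smul_apply, ContinuousLinearMap.smulRight_apply, hcd, h1, h2, map_add,
        map_smul, map_smul]
    have h4 := fderiv_coordInv_chart φ hy hφy (∑ i, (P u (stdVec k) i •
          (pushConnection φ.symm D fun z ↦ chartFrame x z (stdVec i)) y (chartFrame x y (P u a)) +
          fderiv ℝ P u a (stdVec k) i • chartFrame x y (stdVec i)))
    rw [← h3] at h4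
    refine h4.trans ?_
    rw [map_sum]
    simp only [map_add, map_smul, chart_chartFrame hy]
    rw [Finset.sum_add_distrib]
    exact congrArg₂ (· + ·) rfl (sum_coord_smul_stdVec _)
  intro a b
  rw [connectionSymbols_chart D hφy, coordInv_chart φ hφy, connectionSymbols_chart _ hy]
  simp only [sum_apply, ContinuousLinearMap.comp_apply, ContinuousLinearMap.smulRightL_apply_apply,
    ContinuousLinearMap.smulRight_apply, map_sum, map_smul, EuclideanSpace.coe_proj]
  have hb (L : Model n →L[ℝ] Model n) : L b = ∑ k, b k • L (stdVec k) := by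
    conv_lhs => rw [← sum_coord_smul_stdVec b]
    simp only [map_sum, map_smul]
  have h₁ : ∑ k, b k • fderiv ℝ P u a (stdVec k) = fderiv ℝ P u a b := (hb _).symm
  have h₂ (i : Fin n) : ∑ k, b k * P u (stdVec k) i = P u b i := by
    rw [hb (P u)]
    simp
  trans ∑ k, b k • (∑ i, (P u (stdVec k) i • endInFrame
        (pushConnection φ.symm D fun z ↦ chartFrame x z (stdVec i)) x y (P u a)) +
      fderiv ℝ P u a (stdVec k))
  · exact Finset.sum_congr rfl fun k _ ↦ congrArg _ (key a k)
  · simp only [smul_add, Finset.sum_add_distrib, Finset.smul_sum, smul_smul]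
    rw [Finset.sum_comm, h₁]
    simp only [← Finset.sum_smul, h₂]
    rfl

/-- The image of a symmetric linear connection under a diffeomorphism is one. -/
theorem IsSymmetricConnection.push {D : Connection n M} (hD : IsSymmetricConnection D) :
    IsSymmetricConnection (pushConnection φ.symm D) := by
  refine ⟨⟨⟨fun {σ} hσ ↦ ?_⟩⟩, ?_⟩
  · rw [contMDiffOn_univ] at hσ ⊢
    have hσ' : ContMDiff (𝓡 n) (𝓡 n).tangent ∞ (fun y ↦
        (⟨y, VectorField.mpullback (𝓡 n) (𝓡 n) φ.symm σ y⟩ : TangentBundle (𝓡 n) M)) :=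
      ContMDiff.mpullback_vectorField (n := ∞) (by simpa using hσ) φ.symm.contMDiff
        (isInvertible_diffeo φ.symm) (by simp)
    have hA := hD.1.contMDiff.contMDiff (σ := VectorField.mpullback (𝓡 n) (𝓡 n) φ.symm σ)
      (by simpa using hσ'.contMDiffOn)
    rw [contMDiffOn_univ] at hA
    intro x
    refine contMDiffAt_endomorphism.2 ?_
    have hA' := (contMDiffAt_endomorphism.1 (hA (φ x))).comp x φ.contMDiffAt
    have hχ : ContDiffAt ℝ ∞ (coordInv φ x) (extChartAt (𝓡 n) (φ x) (φ x)) :=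
      (contDiffOn_coordInv φ x).contDiffAt
        ((isOpen_coordDomain φ x).mem_nhds (mem_coordDomain φ x))
    have hP : ContMDiffAt (𝓡 n) 𝓘(ℝ, Model n →L[ℝ] Model n) ∞
        (fun y ↦ fderiv ℝ (coordInv φ x) (extChartAt (𝓡 n) (φ x) (φ y))) x :=
      (contDiffAt_fderiv hχ).contMDiffAt.comp x (contMDiffAt_extChartAt.comp x φ.contMDiffAt)
    have hi := isInvertible_fderiv_coordInv φ (mem_extChartAt_source (I := 𝓡 n) x)
      (mem_extChartAt_source (I := 𝓡 n) (φ x))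
    have hQ : ContMDiffAt (𝓡 n) 𝓘(ℝ, Model n →L[ℝ] Model n) ∞
        (fun y ↦ (fderiv ℝ (coordInv φ x) (extChartAt (𝓡 n) (φ x) (φ y))).inverse) x :=
      hi.contDiffAt_map_inverse.contMDiffAt.comp x hP
    -- in coordinates the new endomorphism field is the old one conjugated by the Jacobian matrix
    refine ((hP.clm_comp hA').clm_comp hQ).congr_of_eventuallyEq ?_
    filter_upwards [extChartAt_source_mem_nhds (I := 𝓡 n) x,
      φ.continuous.continuousAt.preimage_mem_nhds (extChartAt_source_mem_nhds (I := 𝓡 n) (φ x))]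
      with y hy hφy
    ext1 a'
    obtain ⟨e, he⟩ := isInvertible_fderiv_coordInv φ hy hφy
    obtain ⟨a, rfl⟩ : ∃ a, e a = a' := ⟨e.symm a', by simp⟩
    have hea : fderiv ℝ (coordInv φ x) (extChartAt (𝓡 n) (φ x) (φ y)) a = e a := by
      rw [← he]
      rfl
    have h1 := fderiv_coordInv_chart φ hy hφy (pushConnection φ.symm D σ y (chartFrame x y (e a)))
    have h2 := chartFrame_apply_diffeo φ hy hφy a
    rw [mfderiv_pushConnection_symm, ← hea, ← h2] at h1
    simp only [ContinuousLinearMap.comp_apply, endInFrame, Function.comp_apply]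
    rw [← he, ContinuousLinearMap.inverse_equiv] at *
    have h3 : (e.symm : Model n →L[ℝ] Model n) (e a) = a := e.symm_apply_apply a
    rw [h3]
    exact h1.symm
  · rw [CovariantDerivative.torsion_eq_zero_iff]
    intro X Y y hX hY
    -- the Lie bracket commutes with the push-forward of vector fields
    have hX' := MDifferentiableAt.mpullback_vectorField (n := ∞) (f := φ.symm) (x₀ := φ y)
      (V := X) (by rwa [φ.symm_apply_apply]) φ.symm.contMDiffAt (isInvertible_diffeo φ.symm _)
      (by norm_cast)
    have hY' := MDifferentiableAt.mpullback_vectorField (n := ∞) (f := φ.symm) (x₀ := φ y)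
      (V := Y) (by rwa [φ.symm_apply_apply]) φ.symm.contMDiffAt (isInvertible_diffeo φ.symm _)
      (by norm_cast)
    have h := D.torsion_eq_zero_iff.1 hD.2 hX' hY'
    have : IsManifold (𝓡 n) (minSmoothness ℝ 2) M := by
      rw [minSmoothness_of_isRCLikeNormedField]
      infer_instance
    rw [← VectorField.mpullback_mlieBracket (n := ∞) (by rwa [φ.symm_apply_apply])
      (by rwa [φ.symm_apply_apply]) φ.symm.contMDiffAt (by simpa using ENat.LEInfty.out),
      mpullback_symm, mpullback_symm, mpullback_symm, ← mfderiv_pushConnection_symm,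
      ← mfderiv_pushConnection_symm, ← map_sub] at h
    obtain ⟨e, he⟩ := isInvertible_diffeo φ y
    rw [← he] at h
    exact e.injective h

end ConnectionNaturality

/-! ### Volume forms and orientations -/

section Determinants

variable {n : ℕ}

theorem det_pullForm (b : Model n →L[ℝ] Model n →L[ℝ] ℝ) (P : Model n →L[ℝ] Model n) :
    Matrix.det (Matrix.of fun i k ↦ pullForm b P (stdVec i) (stdVec k)) =
      P.det ^ 2 * Matrix.det (Matrix.of fun i k ↦ b (stdVec i) (stdVec k)) := by
  let e := (EuclideanSpace.basisFun (Fin n) ℝ).toBasis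
  let A := LinearMap.toMatrix e e (P : Model n →ₗ[ℝ] Model n)
  have hA (i l : Fin n) : A l i = P (stdVec i) l := by
    simp [A, e, LinearMap.toMatrix_apply]
  have h : (Matrix.of fun i k ↦ pullForm b P (stdVec i) (stdVec k)) =
      A.transpose * (Matrix.of fun i k ↦ b (stdVec i) (stdVec k)) * A := by
    ext i k
    simp only [Matrix.of_apply, pullForm_apply, Matrix.mul_apply, Matrix.transpose_apply, hA]
    conv_lhs => rw [← sum_coord_smul_stdVec (P (stdVec i)), ← sum_coord_smul_stdVec (P (stdVec k))]
    simp only [map_sum, map_smul, sum_apply, smul_apply, smul_eq_mul]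
    refine Finset.sum_congr rfl fun m _ ↦ ?_
    rw [Finset.sum_mul, Finset.mul_sum]
    exact Finset.sum_congr rfl fun l _ ↦ by ring
  rw [h, Matrix.det_mul, Matrix.det_mul, Matrix.det_transpose, LinearMap.det_toMatrix,
    ContinuousLinearMap.det]
  ring

theorem alternating_apply_clm (α : Model n [⋀^Fin n]→L[ℝ] ℝ) (P : Model n →L[ℝ] Model n) :
    α (fun i ↦ P (stdVec i)) = P.det * α stdVec := by
  let e := (EuclideanSpace.basisFun (Fin n) ℝ).toBasis
  have he : (e : Fin n → Model n) = stdVec := by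
    ext1 i
    simp [e]
  have h (w : Fin n → Model n) : α w = α e * e.det w := by
    have := DFunLike.congr_fun (α.toAlternatingMap.eq_smul_basis_det e) w
    simpa using this
  have h' := e.det_comp (P : Model n →ₗ[ℝ] Model n) e
  rw [e.det_self, mul_one] at h'
  rw [h, ContinuousLinearMap.det, ← h', ← he, mul_comm]
  rfl

end Determinants

section Orientation

variable {n : ℕ} {M : Type*} [TopologicalSpace M] [ChartedSpace (Model n) M]
  [IsManifold (𝓡 n) ∞ M] (φ : M ≃ₘ⟮𝓡 n, 𝓡 n⟯ M) (v : VolumeForm n M)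

/-- A form of top degree is determined by its value on a coordinate frame. -/
theorem form_ext {x y : M} (hy : y ∈ (extChartAt (𝓡 n) x).source)
    {α β : TangentSpace (𝓡 n) y [⋀^Fin n]→L[ℝ] ℝ}
    (h : (α fun i ↦ chartFrame x y (stdVec i)) = β fun i ↦ chartFrame x y (stdVec i)) : α = β := by
  obtain ⟨e, he⟩ := (isInvertible_chart hy).inverse
  let b := (EuclideanSpace.basisFun (Fin n) ℝ).toBasis.map e.toLinearEquiv
  have hb : (b : Fin n → TangentSpace (𝓡 n) y) = fun i ↦ chartFrame x y (stdVec i) := by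
    ext1 i
    rw [chartFrame, ← he]
    exact congrArg e (show (EuclideanSpace.basisFun (Fin n) ℝ).toBasis i = stdVec i by simp)
  rw [← hb] at h
  ext w
  have h1 := DFunLike.congr_fun (α.toAlternatingMap.eq_smul_basis_det b) w
  have h2 := DFunLike.congr_fun (β.toAlternatingMap.eq_smul_basis_det b) w
  refine h1.trans (Eq.trans ?_ h2.symm)
  exact congrArg (fun r : ℝ ↦ (r • b.det) w) h

theorem VolumeForm.apply_ne_zero {x y : M} (hy : y ∈ (extChartAt (𝓡 n) x).source) :
    (v.form y fun i ↦ chartFrame x y (stdVec i)) ≠ 0 :=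
  fun h ↦ v.ne_zero y (form_ext hy h)

/-- The pullback `φ^* v` of the volume form. -/
def pulledForm (y : M) : TangentSpace (𝓡 n) y [⋀^Fin n]→L[ℝ] ℝ :=
  (v.form (φ y)).compContinuousLinearMap (mfderiv (𝓡 n) (𝓡 n) φ y)

/-- The function `c` with `φ^* v = c v`, computed in the coordinate frame of the preferred chart at
each point. -/
def jacobian (y : M) : ℝ :=
  (pulledForm φ v y fun i ↦ chartFrame y y (stdVec i)) /
    v.form y fun i ↦ chartFrame y y (stdVec i)

theorem pulledForm_eq (y : M) : pulledForm φ v y = jacobian φ v y • v.form y := by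
  refine form_ext (mem_extChartAt_source (I := 𝓡 n) y) ?_
  rw [ContinuousAlternatingMap.smul_apply, smul_eq_mul, jacobian,
    div_mul_cancel₀ _ (v.apply_ne_zero (mem_extChartAt_source (I := 𝓡 n) y))]

theorem volumeForm_chartFrame {x y : M} (hy : y ∈ (extChartAt (𝓡 n) x).source)
    (hφy : φ y ∈ (extChartAt (𝓡 n) (φ x)).source) :
    (v.form (φ y) fun i ↦ chartFrame (φ x) (φ y) (stdVec i)) =
      (fderiv ℝ (coordInv φ x) (extChartAt (𝓡 n) (φ x) (φ y))).det * (jacobian φ v y *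
        v.form y fun i ↦ chartFrame x y (stdVec i)) := by
  have h1 := alternating_apply_clm ((pulledForm φ v y).compContinuousLinearMap (chartFrame x y))
    (fderiv ℝ (coordInv φ x) (extChartAt (𝓡 n) (φ x) (φ y)))
  have h2 := DFunLike.congr_fun (pulledForm_eq φ v y) fun i ↦ chartFrame x y (stdVec i)
  have h3 : (fun i ↦ chartFrame (φ x) (φ y) (stdVec i)) = fun i : Fin n ↦
      mfderiv (𝓡 n) (𝓡 n) φ y (chartFrame x y
        (fderiv ℝ (coordInv φ x) (extChartAt (𝓡 n) (φ x) (φ y)) (stdVec i))) :=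
    funext fun i ↦ chartFrame_apply_diffeo φ hy hφy _
  rw [h3]
  refine h1.trans (congrArg _ ?_)
  exact h2

theorem jacobian_ne_zero (y : M) : jacobian φ v y ≠ 0 := by
  intro h
  have := volumeForm_chartFrame φ v (mem_extChartAt_source (I := 𝓡 n) y)
    (mem_extChartAt_source (I := 𝓡 n) (φ y))
  rw [h, zero_mul, mul_zero] at this
  exact v.apply_ne_zero (mem_extChartAt_source (I := 𝓡 n) (φ y)) this

theorem det_ne_zero_of_isInvertible {P : Model n →L[ℝ] Model n} (h : P.IsInvertible) :
    P.det ≠ 0 := by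
  obtain ⟨e, rfl⟩ := h
  exact (LinearEquiv.isUnit_det' e.toLinearEquiv).ne_zero

theorem continuous_jacobian : Continuous (jacobian φ v) := by
  rw [continuous_iff_continuousAt]
  intro x
  have hχ : ContDiffAt ℝ ∞ (coordInv φ x) (extChartAt (𝓡 n) (φ x) (φ x)) :=
    (contDiffOn_coordInv φ x).contDiffAt ((isOpen_coordDomain φ x).mem_nhds (mem_coordDomain φ x))
  have hφ := φ.continuous.continuousAt (x := x)
  have h1 : ContinuousAt
      (fun y ↦ (fderiv ℝ (coordInv φ x) (extChartAt (𝓡 n) (φ x) (φ y))).det) x := by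
    refine ContinuousLinearMap.continuous_det.continuousAt.comp ?_
    exact ContinuousAt.comp (f := fun y ↦ extChartAt (𝓡 n) (φ x) (φ y))
      (contDiffAt_fderiv hχ).continuousAt ((continuousAt_extChartAt (I := 𝓡 n) (φ x)).comp hφ)
  have h2 : ContinuousAt (fun y ↦ v.form (φ y) fun i ↦ chartFrame (φ x) (φ y) (stdVec i)) x :=
    ContinuousAt.comp (g := fun z ↦ v.form z fun i ↦ chartFrame (φ x) z (stdVec i))
      (continuousAt_volumeForm v (φ x)) hφ
  have hx := mem_extChartAt_source (I := 𝓡 n) x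
  have hφx := mem_extChartAt_source (I := 𝓡 n) (φ x)
  have h3 := h2.div (h1.mul (continuousAt_volumeForm v x))
    (mul_ne_zero (det_ne_zero_of_isInvertible (isInvertible_fderiv_coordInv φ hx hφx))
      (v.apply_ne_zero hx))
  refine h3.congr ?_
  filter_upwards [extChartAt_source_mem_nhds (I := 𝓡 n) x,
    hφ.preimage_mem_nhds (extChartAt_source_mem_nhds (I := 𝓡 n) (φ x))] with y hy hφy
  have h4 := v.apply_ne_zero hy
  have h5 := det_ne_zero_of_isInvertible (isInvertible_fderiv_coordInv φ hy hφy)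
  simp only [Pi.div_apply, Pi.mul_apply]
  rw [volumeForm_chartFrame φ v hy hφy]
  field_simp

theorem jacobian_pos_or_neg [PreconnectedSpace M] :
    (∀ y, 0 < jacobian φ v y) ∨ ∀ y, jacobian φ v y < 0 := by
  by_contra! h
  obtain ⟨⟨y, hy⟩, z, hz⟩ := h
  obtain ⟨w, hw⟩ := mem_range_of_exists_le_of_exists_ge (continuous_jacobian φ v) ⟨y, hy⟩ ⟨z, hz⟩
  exact jacobian_ne_zero φ v w hw

end Orientation

/-! ### Lagrangians under diffeomorphisms -/

section Metrics

variable {p q : ℕ} {M : Type*} [TopologicalSpace M] [ChartedSpace (Model (p + q)) M]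

theorem HasSignature.symm {V : Type*} [AddCommGroup V] [Module ℝ V] [TopologicalSpace V]
    [IsTopologicalAddGroup V] [ContinuousSMul ℝ V] {b : V →L[ℝ] V →L[ℝ] ℝ}
    (h : HasSignature p q b) (v w : V) : b v w = b w v := by
  obtain ⟨e, he⟩ := h
  rw [← e.sum_repr v, ← e.sum_repr w]
  simp only [map_sum, map_smul, sum_apply, smul_apply, he]
  simp only [smul_eq_mul, mul_ite, mul_zero, Finset.sum_ite_eq', Finset.mem_univ, if_true]
  exact Finset.sum_congr rfl fun i _ ↦ mul_left_comm _ _ _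

variable [IsManifold (𝓡 (p + q)) ∞ M]

theorem LocalMetric.isMetricNear {x : M} (g : LocalMetric p q x) :
    IsMetricNear (formInChart g.form x) (extChartAt (𝓡 (p + q)) x x) := by
  have hcont : Filter.Tendsto (extChartAt (𝓡 (p + q)) x).symm
      (𝓝 (extChartAt (𝓡 (p + q)) x x)) (𝓝 x) := by
    simpa using (continuousAt_extChartAt_symm (I := 𝓡 (p + q)) x).tendsto
  refine ⟨g.smooth, ?_, ?_⟩
  · filter_upwards [hcont.eventually g.signature] with w hw a b
    exact hw.symm _ _
  · filter_upwards [hcont.eventually g.signature,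
      extChartAt_target_mem_nhds (I := 𝓡 (p + q)) x] with w hw hwt
    obtain ⟨e, he⟩ := isInvertible_chart ((extChartAt (𝓡 (p + q)) x).map_target hwt)
    apply isInvertible_of_injective
    rw [formInChart, formInFrame, chartFrame, ← he, ContinuousLinearMap.inverse_equiv]
    exact (hw.pull e.symm).injective

variable (φ : M ≃ₘ⟮𝓡 (p + q), 𝓡 (p + q)⟯ M)

theorem sameJet_push_pullMetric {x : M} (g : LocalMetric p q x) (r : ℕ) :
    SameJet r (formInChart (g.push φ).form (φ x)) (pullMetric (coordInv φ x) (formInChart g.form x))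
      (extChartAt (𝓡 (p + q)) (φ x) (φ x)) := by
  refine SameJet.congr (fun _ _ ↦ rfl) ?_ Filter.EventuallyEq.rfl
  filter_upwards [(isOpen_coordDomain φ x).mem_nhds (mem_coordDomain φ x)] with w hw
  exact pushField_inChart φ x g.form hw

end Metrics

section Diffeo

variable {n : ℕ} {M : Type*} [TopologicalSpace M] [ChartedSpace (Model n) M]
  [IsManifold (𝓡 n) ∞ M] (φ : M ≃ₘ⟮𝓡 n, 𝓡 n⟯ M)

theorem isCoordChangeNear_coordInv (x : M) :
    IsCoordChangeNear (coordInv φ x) (extChartAt (𝓡 n) (φ x) (φ x)) := by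
  have hmem := (isOpen_coordDomain φ x).mem_nhds (mem_coordDomain φ x)
  constructor
  · filter_upwards [hmem] with w hw
    exact (contDiffOn_coordInv φ x).contDiffAt ((isOpen_coordDomain φ x).mem_nhds hw)
  · filter_upwards [hmem] with w hw
    obtain ⟨y, hy, hφy, rfl⟩ := exists_of_mem_coordDomain φ hw
    exact isInvertible_fderiv_coordInv φ hy hφy

theorem connectionSymbols_related_near (D : Connection n M) (x : M) :
    ∀ᶠ w in 𝓝 (extChartAt (𝓡 n) (φ x) (φ x)), SymbolsRelated (coordInv φ x)
      (connectionSymbols (pushConnection φ.symm D) x) (connectionSymbols D (φ x)) w := by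
  filter_upwards [(isOpen_coordDomain φ x).mem_nhds (mem_coordDomain φ x)] with w hw
  obtain ⟨y, hy, hφy, rfl⟩ := exists_of_mem_coordDomain φ hw
  exact connectionSymbols_related φ D hy hφy

end Diffeo

section Jets

variable {p q : ℕ} {M : Type*} [TopologicalSpace M] [ChartedSpace (Model (p + q)) M]

theorem Jet.exists_toOne (j : Jet p q M 1) : ∃ j' : Jet p q M 2, j'.toOne = j := by
  obtain ⟨x, g⟩ := j
  induction g using Quotient.inductionOn with | h g => ?_
  exact ⟨jet 2 g, rfl⟩

end Jets

section Lagrangians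

variable {p q : ℕ} {M : Type*} [TopologicalSpace M] [ChartedSpace (Model (p + q)) M]
  [IsManifold (𝓡 (p + q)) ∞ M] (φ : M ≃ₘ⟮𝓡 (p + q), 𝓡 (p + q)⟯ M)

theorem lagrangianPrime_jetLift [T2Space M] {D : Connection (p + q) M}
    (hD : IsSymmetricConnection D) (j : Jet p q M 2) :
    lagrangianPrime D (jetLift φ 2 j) = lagrangianPrime (pushConnection φ.symm D) j := by
  obtain ⟨x, g⟩ := j
  induction g using Quotient.inductionOn with | h g => ?_
  have hχ := isCoordChangeNear_coordInv φ x
  have hg : IsMetricNear (formInChart g.form x)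
      (coordInv φ x (extChartAt (𝓡 (p + q)) (φ x) (φ x))) := by
    rw [coordInv_base]
    exact g.isMetricNear
  have h1 := lagrangianPrimeCoord_congr (connectionSymbols D (φ x)) (sameJet_push_pullMetric φ g 2)
    (g.push φ).contDiffAt (hg.pull hχ).smooth.self_of_nhds (g.push φ).isInvertible
  have h2 := lagrangianPrimeCoord_pullMetric hg hχ (connectionSymbols_related_near φ D x)
    (by rw [coordInv_base]
        exact (contDiffAt_connectionSymbols (hD.push φ).1 x).differentiableAt (by simp))
    ((contDiffAt_connectionSymbols hD.1 (φ x)).differentiableAt (by simp))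
  rw [coordInv_base] at h2
  exact h1.trans h2

theorem jetScalarCurvature_jetLift (j : Jet p q M 2) :
    jetScalarCurvature (jetLift φ 2 j) = jetScalarCurvature j := by
  obtain ⟨x, g⟩ := j
  induction g using Quotient.inductionOn with | h g => ?_
  have hχ := isCoordChangeNear_coordInv φ x
  have hg : IsMetricNear (formInChart g.form x)
      (coordInv φ x (extChartAt (𝓡 (p + q)) (φ x) (φ x))) := by
    rw [coordInv_base]
    exact g.isMetricNear
  have h1 := scalarCurvature_congr (sameJet_push_pullMetric φ g 2)
    (g.push φ).contDiffAt (hg.pull hχ).smooth.self_of_nhds (g.push φ).isInvertible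
  have h2 := scalarCurvature_pullMetric hg hχ
  rw [coordInv_base] at h2
  exact h1.trans h2

/-- The change of variables formula `φ^* v_{φ·g} = ± v_g`, as `φ^* v = c v` with `c` the
Jacobian. -/
theorem jetRho_jetLift (v : VolumeForm (p + q) M) {r : ℕ} (j : Jet p q M r) :
    jetRho v (jetLift φ r j) * |jacobian φ v j.1| = jetRho v j := by
  obtain ⟨x, g⟩ := j
  induction g using Quotient.inductionOn with | h g => ?_
  have hx := mem_extChartAt_source (I := 𝓡 (p + q)) x
  have hφx := mem_extChartAt_source (I := 𝓡 (p + q)) (φ x)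
  set P := fderiv ℝ (coordInv φ x) (extChartAt (𝓡 (p + q)) (φ x) (φ x)) with hP
  have h0 : formInChart (g.push φ).form (φ x) (extChartAt (𝓡 (p + q)) (φ x) (φ x)) =
      pullForm (formInChart g.form x (extChartAt (𝓡 (p + q)) x x)) P := by
    have := pushField_inChart φ x g.form (mem_coordDomain φ x)
    rwa [coordInv_base] at this
  change √|Matrix.det (Matrix.of fun i k ↦ formInChart (g.push φ).form (φ x)
      (extChartAt (𝓡 (p + q)) (φ x) (φ x)) (stdVec i) (stdVec k))| /
      |v.form (φ x) fun i ↦ chartFrame (φ x) (φ x) (stdVec i)| * |jacobian φ v x| =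
    √|Matrix.det (Matrix.of fun i k ↦ formInChart g.form x
      (extChartAt (𝓡 (p + q)) x x) (stdVec i) (stdVec k))| /
      |v.form x fun i ↦ chartFrame x x (stdVec i)|
  have h1 := abs_ne_zero.2
    (det_ne_zero_of_isInvertible (isInvertible_fderiv_coordInv φ hx hφx))
  have h2 := abs_ne_zero.2 (jacobian_ne_zero φ v x)
  have h3 := abs_ne_zero.2 (v.apply_ne_zero hx)
  rw [h0, det_pullForm, volumeForm_chartFrame φ v hx hφx, abs_mul, abs_mul, abs_mul, abs_pow,
    Real.sqrt_mul (by positivity), Real.sqrt_sq (abs_nonneg _)]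
  rw [← hP] at h1 ⊢
  field_simp

/-- The Lagrangian `L^D` depends only on the `1`-jet. -/
theorem lagrangian_congr [T2Space M] (v : VolumeForm (p + q) M) {D : Connection (p + q) M}
    (hD : IsSymmetricConnection D) {j j' : Jet p q M 2} (h : j.toOne = j'.toOne) :
    lagrangian v D j = lagrangian v D j' := by
  obtain ⟨x, g⟩ := j
  obtain ⟨x', g'⟩ := j'
  obtain rfl : x = x' := congrArg Sigma.fst h
  induction g using Quotient.inductionOn with | h g => ?_
  induction g' using Quotient.inductionOn with | h g' => ?_
  have h' : SameJet 1 (formInChart g.form x) (formInChart g'.form x)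
      (extChartAt (𝓡 (p + q)) x x) := Quotient.exact (eq_of_heq (Sigma.mk.inj h).2)
  have h1 := scalarCurvature_add_lagrangianPrimeCoord_congr g.isMetricNear g'.isMetricNear
    ((contDiffAt_connectionSymbols hD.1 x).differentiableAt (by simp)) h'
  refine congrArg₂ (· * ·) h1 ?_
  change √|Matrix.det (Matrix.of fun i k ↦ formInChart g.form x _ (stdVec i) (stdVec k))| / _ =
    √|Matrix.det (Matrix.of fun i k ↦ formInChart g'.form x _ (stdVec i) (stdVec k))| / _
  rw [h'.eq_zero]

theorem jetLift_toOne (j : Jet p q M 2) : jetLift φ 1 j.toOne = (jetLift φ 2 j).toOne := by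
  obtain ⟨x, g⟩ := j
  induction g using Quotient.inductionOn with | h g => rfl

theorem exists_factor [T2Space M] (v : VolumeForm (p + q) M) {D : Connection (p + q) M}
    (hD : IsSymmetricConnection D) :
    ∃ ℓ : Jet p q M 1 → ℝ, lagrangian v D = ℓ ∘ Jet.toOne :=
  ⟨fun j ↦ lagrangian v D j.exists_toOne.choose,
    funext fun j ↦ lagrangian_congr v hD j.toOne.exists_toOne.choose_spec.symm⟩

/-- The scalar factor of `L^D` is natural, and the volume factor is divided by the Jacobian up to
sign. -/
theorem lagrangian_jetLift [T2Space M] (v : VolumeForm (p + q) M) {D : Connection (p + q) M}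
    (hD : IsSymmetricConnection D) (j : Jet p q M 2) :
    lagrangian v D (jetLift φ 2 j) * |jacobian φ v j.1| =
      lagrangian v (pushConnection φ.symm D) j := by
  rw [lagrangian, lagrangian, lagrangianPrime_jetLift φ hD, jetScalarCurvature_jetLift, mul_assoc,
    jetRho_jetLift]

theorem pullDensity_apply (v : VolumeForm (p + q) M) {r : ℕ} (ℓ : Jet p q M r → ℝ)
    (j : Jet p q M r) : pullDensity φ (densityOf v ℓ) j =
      (ℓ (jetLift φ r j) * jacobian φ v j.1) • v.form j.1 := by
  rw [mul_smul, ← pulledForm_eq]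
  rfl

theorem preservesOrientation_iff (v : VolumeForm (p + q) M) :
    PreservesOrientation v φ ↔ ∀ x, 0 < jacobian φ v x := by
  refine forall_congr' fun x ↦ ⟨fun ⟨c, hc, h⟩ ↦ ?_, fun h ↦ ⟨_, h, pulledForm_eq φ v x⟩⟩
  rw [← smul_left_injective ℝ (v.ne_zero x) (h.symm.trans (pulledForm_eq φ v x))]
  exact hc

theorem reversesOrientation_iff (v : VolumeForm (p + q) M) :
    ReversesOrientation v φ ↔ ∀ x, jacobian φ v x < 0 := by
  refine forall_congr' fun x ↦ ⟨fun ⟨c, hc, h⟩ ↦ ?_, fun h ↦ ⟨_, h, pulledForm_eq φ v x⟩⟩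
  rw [← smul_left_injective ℝ (v.ne_zero x) (h.symm.trans (pulledForm_eq φ v x))]
  exact hc

end Lagrangians

end EHLagrangian

end

open EHLagrangian
theorem mainTheorem4 {M : Type*} [TopologicalSpace M] [T2Space M] [SecondCountableTopology M]
    [ConnectedSpace M] (p q : ℕ) [ChartedSpace (Model (p + q)) M] [IsManifold (𝓡 (p + q)) ∞ M]
    (v : VolumeForm (p + q) M) (D : Connection (p + q) M) (hD : IsSymmetricConnection D)
    (φ : M ≃ₘ⟮𝓡 (p + q), 𝓡 (p + q)⟯ M) :
    IsSymmetricConnection (pushConnection φ.symm D) ∧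
    (lagrangianPrime D ∘ jetLift φ 2 : Jet p q M 2 → ℝ) =
      lagrangianPrime (pushConnection φ.symm D) ∧
    (PreservesOrientation v φ ∨ ReversesOrientation v φ) ∧
    ∃ ℓ ℓ' : Jet p q M 1 → ℝ,
      lagrangian v D = ℓ ∘ Jet.toOne ∧
      lagrangian v (pushConnection φ.symm D) = ℓ' ∘ Jet.toOne ∧
      (PreservesOrientation v φ → pullDensity φ (densityOf v ℓ) = densityOf v ℓ') ∧
      (ReversesOrientation v φ → pullDensity φ (densityOf v ℓ) = -densityOf v ℓ') := by
  obtain ⟨ℓ, hℓ⟩ := exists_factor v hD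
  obtain ⟨ℓ', hℓ'⟩ := exists_factor v (hD.push φ)
  have key (j : Jet p q M 1) : ℓ (jetLift φ 1 j) * |jacobian φ v j.1| = ℓ' j := by
    obtain ⟨j, rfl⟩ := j.exists_toOne
    have h := lagrangian_jetLift φ v hD j
    rw [hℓ, hℓ', Function.comp_apply, Function.comp_apply, ← jetLift_toOne] at h
    exact h
  refine ⟨hD.push φ, funext fun j ↦ lagrangianPrime_jetLift φ hD j, ?_, ℓ, ℓ', hℓ, hℓ', ?_, ?_⟩
  · rw [preservesOrientation_iff, reversesOrientation_iff]
    exact jacobian_pos_or_neg φ v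
  · intro h
    rw [preservesOrientation_iff] at h
    ext1 j
    rw [pullDensity_apply, ← abs_of_pos (h j.1), key]
    rfl
  · intro h
    rw [reversesOrientation_iff] at h
    ext1 j
    have hj := key j
    rw [abs_of_neg (h j.1), mul_neg, neg_eq_iff_eq_neg] at hj
    rw [pullDensity_apply, hj, neg_smul]
    rfl
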